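/- All manifolds are smooth ($C^\infty$), finite-dimensional, Hausdorff and second countable; a distribution is a smooth vector subbundle of the tangent bundle. Let $\widetilde{\mathcal S}$ be a manifold with a tuple of distributions $(\widetilde\Delta,\mathcal C,\{\mathcal V_i\}_{i\in\mathbb Z})$ such that (P1) $\mathcal C$ and all $\mathcal V_i$ are subdistributions of $\widetilde\Delta$; (P2) $\mathcal C$ is integrable and $[\mathcal C,\widetilde\Delta]\subset\widetilde\Delta$; (P3) $\mathcal V_i\subset\mathcal V_{i-1}$ and $[\mathcal C,\mathcal V_i]\subseteq\mathcal V_{i-1}+\mathcal C$ for every $i$, and there are integers $r,s$ such that $\mathcal V_i+\mathcal C=\mathcal V_r+\mathcal C$ for $i\le r$ and $\mathcal V_i=\mathcal V_s$ for $i\ge s$; (P4) for every $i$ the dimension of $\mathcal V_i(x)\cap\mathcal C(x)$ is the same at all points $x\in\widetilde{\mathcal S}$. Assume that the quotient manifold $\mathcal S$ of $\widetilde{\mathcal S}$ by the foliation by maximal integral submanifolds of $\mathcal C$ exists, i.e. there is a surjective submersion $\Phi:\widetilde{\mathcal S}\to\mathcal S$ with connected fibres and $\ker d\Phi=\mathcal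 C$. The linearization procedure assigns to the tuple the flag structure $(\Delta,\{\mathcal Y^\gamma\}_{\gamma\in\mathcal S})$ on $\mathcal S$, where $\Delta=\Phi_*\widetilde\Delta$ and $\mathcal Y^\gamma$ is the set of all flags $\{\Phi_*(\mathcal V_i(x))\}_{i\in\mathbb Z}$ in $\Delta(\gamma)$ with $x\in\Phi^{-1}(\gamma)$. Assume that $\widetilde{\mathcal S}\to\mathcal S$ is the tautological bundle of this flag structure, i.e. $x\mapsto\bigl(\Phi(x),\{\Phi_*(\mathcal V_i(x))\}_{i\in\mathbb Z}\bigr)$ is a smooth embedding of $\widetilde{\mathcal S}$ into the bundle of flags of $T\mathcal S$ (topologized and differentiated through the Grassmannians of $T\mathcal S$). An intrinsic recovery procedure is a rule $R$ which assigns, on every manifold, to fields of subspaces $(\widetilde\Delta,\mathcal C,\{\mathcal W_i\}_{i\in\mathbb Z})$ of the tangent bundle a family $\{R_i\}_{i\in\mathbb Z}$ of fields of subspaces and commutes with diffeomorphisms. A tuple $(\widetilde\Delta,\mathcal C,\{\mathcal V_i\})$ is recoverable by the linearization procedure, by means of $R$, if $R_i(\widetilde\Delta,\mathcal C,\{\mathcal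 V_j+\mathcal C\}_{j\in\mathbb Z})=\mathcal V_i$ for every $i$. Two tuples, on $\widetilde{\mathcal S}$ and $\widetilde{\mathcal S}^1$, are equivalent if a diffeomorphism $\widetilde{\mathcal S}\to\widetilde{\mathcal S}^1$ carries $\widetilde\Delta$, $\mathcal C$ and each $\mathcal V_i$ onto $\widetilde\Delta^1$, $\mathcal C^1$ and $\mathcal V_i^1$. Two flag structures, on $\mathcal S$ and $\mathcal S^1$, are equivalent if there is a diffeomorphism $\varphi:\mathcal S\to\mathcal S^1$ with $\varphi_*\Delta=\Delta^1$ and $\varphi_*(\mathcal Y^\gamma)=\mathcal Y^{1,\varphi(\gamma)}$, as sets of flags, for every $\gamma\in\mathcal S$. **Corollary.** Let two tuples of distributions, on two manifolds, satisfy all of the above and be recoverable by the linearization procedure by means of the same intrinsic recovery procedure. Then the two tuples are equivalent if and only if the flag structures obtained from them by the linearization procedure are equivalent. -/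

import Mathlib

open scoped Manifold ContDiff Topology

universe u v w

namespace FlagLinearization

/-- A field of subspaces `D x ⊆ T_x M` on an `n`-dimensional manifold (no regularity yet). -/
abbrev PlaneField (n : ℕ) (M : Type*) [TopologicalSpace M]
    [ChartedSpace (EuclideanSpace ℝ (Fin n)) M] :=
  ∀ x : M, Submodule ℝ (TangentSpace (𝓡 n) x)

/-- The vector field `X` is smooth on the set `U`. -/
def IsSmoothFieldOn {n : ℕ} {M : Type*} [TopologicalSpace M]
    [ChartedSpace (EuclideanSpace ℝ (Fin n)) M] [IsManifold (𝓡 n) ∞ M]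
    (X : ∀ x : M, TangentSpace (𝓡 n) x) (U : Set M) : Prop :=
  ContMDiffOn (𝓡 n) (𝓡 n).tangent ∞ (fun x => (⟨x, X x⟩ : TangentBundle (𝓡 n) M)) U

/-- A (vector) distribution: a smooth vector subbundle of the tangent bundle, i.e. a field of
subspaces which locally has a smooth frame. -/
def IsDistribution {n : ℕ} {M : Type*} [TopologicalSpace M]
    [ChartedSpace (EuclideanSpace ℝ (Fin n)) M] [IsManifold (𝓡 n) ∞ M]
    (D : PlaneField n M) : Prop :=
  ∀ x₀ : M, ∃ U : Set M, IsOpen U ∧ x₀ ∈ U ∧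
    ∃ (k : ℕ) (X : Fin k → ∀ x : M, TangentSpace (𝓡 n) x),
      (∀ j, IsSmoothFieldOn (X j) U) ∧
      ∀ x ∈ U, LinearIndependent ℝ (fun j => X j x) ∧
        Submodule.span ℝ (Set.range fun j => X j x) = D x

/-- `[A, B] ⊆ D`: brackets of (local) smooth sections of `A` and of `B` are tangent to `D`. -/
def BracketSubset {n : ℕ} {M : Type*} [TopologicalSpace M]
    [ChartedSpace (EuclideanSpace ℝ (Fin n)) M] [IsManifold (𝓡 n) ∞ M]
    (A B D : PlaneField n M) : Prop :=
  ∀ U : Set M, IsOpen U → ∀ X Y : (∀ x : M, TangentSpace (𝓡 n) x),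
    IsSmoothFieldOn X U → IsSmoothFieldOn Y U →
    (∀ x ∈ U, X x ∈ A x) → (∀ x ∈ U, Y x ∈ B x) →
    ∀ x ∈ U, VectorField.mlieBracket (𝓡 n) X Y x ∈ D x

/-- The diffeomorphism `F` carries the field of subspaces `D` onto `D'`. -/
def Carries {n n' : ℕ} {M M' : Type*} [TopologicalSpace M]
    [ChartedSpace (EuclideanSpace ℝ (Fin n)) M] [TopologicalSpace M']
    [ChartedSpace (EuclideanSpace ℝ (Fin n')) M']
    (F : M ≃ₘ^∞⟮𝓡 n, 𝓡 n'⟯ M') (D : PlaneField n M) (D' : PlaneField n' M') : Prop :=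
  ∀ x : M, (D x).map (mfderiv (𝓡 n) (𝓡 n') F x).toLinearMap = D' (F x)

/-- A tuple of distributions `(Δ, C, {V i}_{i ∈ ℤ})` on `M`. -/
structure DistributionTuple (n : ℕ) (M : Type*) [TopologicalSpace M]
    [ChartedSpace (EuclideanSpace ℝ (Fin n)) M] [IsManifold (𝓡 n) ∞ M] where
  Δ : PlaneField n M
  C : PlaneField n M
  V : ℤ → PlaneField n M
  isDistribution_Δ : IsDistribution Δ
  isDistribution_C : IsDistribution C
  isDistribution_V : ∀ i, IsDistribution (V i)

/-- The family `V i + C`. -/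
noncomputable def DistributionTuple.VC {n : ℕ} {M : Type*} [TopologicalSpace M]
    [ChartedSpace (EuclideanSpace ℝ (Fin n)) M] [IsManifold (𝓡 n) ∞ M]
    (T : DistributionTuple n M) (i : ℤ) : PlaneField n M :=
  fun x => T.V i x ⊔ T.C x

/-- The four standing properties of a tuple of distributions. -/
structure DistributionTuple.IsAdmissible {n : ℕ} {M : Type*} [TopologicalSpace M]
    [ChartedSpace (EuclideanSpace ℝ (Fin n)) M] [IsManifold (𝓡 n) ∞ M]
    (T : DistributionTuple n M) : Prop where
  /-- First property: `C` and all `V i` are subdistributions of `Δ`. -/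
  C_le : ∀ x, T.C x ≤ T.Δ x
  V_le : ∀ i x, T.V i x ≤ T.Δ x
  /-- Second property: `C` is integrable (in the involutive form) and consists of infinitesimal
  symmetries of `Δ`. -/
  C_integrable : BracketSubset T.C T.C T.C
  C_symm : BracketSubset T.C T.Δ T.Δ
  /-- Third property: the `V i` decrease, `V i + C` does not depend on `i` for `i ≪ 0`, `V i` does
  not depend on `i` for `i ≫ 0`, and `[C, V i] ⊆ V (i - 1) + C`. -/
  V_anti : ∀ i x, T.V i x ≤ T.V (i - 1) x
  V_low : ∃ r : ℤ, ∀ i ≤ r, T.VC i = T.VC r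
  V_high : ∃ s : ℤ, ∀ i ≥ s, T.V i = T.V s
  C_bracket_V : ∀ i, BracketSubset T.C (T.V i) (T.VC (i - 1))
  /-- Fourth property: `V i ∩ C` has constant dimension. -/
  rank_inter : ∀ i x y,
    Module.finrank ℝ ↥(T.V i x ⊓ T.C x) = Module.finrank ℝ ↥(T.V i y ⊓ T.C y)

/-- Two tuples of distributions are equivalent: a diffeomorphism carries one to the other. -/
def TupleEquiv {n n' : ℕ} {M M' : Type*} [TopologicalSpace M]
    [ChartedSpace (EuclideanSpace ℝ (Fin n)) M] [IsManifold (𝓡 n) ∞ M] [TopologicalSpace M']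
    [ChartedSpace (EuclideanSpace ℝ (Fin n')) M'] [IsManifold (𝓡 n') ∞ M']
    (T : DistributionTuple n M) (T' : DistributionTuple n' M') : Prop :=
  ∃ F : M ≃ₘ^∞⟮𝓡 n, 𝓡 n'⟯ M',
    Carries F T.Δ T'.Δ ∧ Carries F T.C T'.C ∧ ∀ i, Carries F (T.V i) (T'.V i)

/-- An intrinsic recovery procedure: a rule which assigns, on every manifold, to a tuple
`(Δ, C, {W i})` a family `{V i}`, and which commutes with diffeomorphisms (it uses nothing but the
tuple itself). -/
structure IntrinsicRecovery where
  recover : ∀ (n : ℕ) (M : Type u) [TopologicalSpace M]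
    [ChartedSpace (EuclideanSpace ℝ (Fin n)) M],
    PlaneField n M → PlaneField n M → (ℤ → PlaneField n M) → ℤ → PlaneField n M
  natural : ∀ (n n' : ℕ) (M M' : Type u)
    [TopologicalSpace M] [T2Space M] [SecondCountableTopology M]
    [ChartedSpace (EuclideanSpace ℝ (Fin n)) M] [IsManifold (𝓡 n) ∞ M]
    [TopologicalSpace M'] [T2Space M'] [SecondCountableTopology M']
    [ChartedSpace (EuclideanSpace ℝ (Fin n')) M'] [IsManifold (𝓡 n') ∞ M']
    (F : M ≃ₘ^∞⟮𝓡 n, 𝓡 n'⟯ M')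
    (Δ C : PlaneField n M) (W : ℤ → PlaneField n M)
    (Δ' C' : PlaneField n' M') (W' : ℤ → PlaneField n' M'),
    Carries F Δ Δ' → Carries F C C' → (∀ i, Carries F (W i) (W' i)) →
    ∀ i, Carries F (recover n M Δ C W i) (recover n' M' Δ' C' W' i)

/-- The tuple is recoverable by the procedure `R`: each `V i` is what `R` produces from
`(Δ, C, {V i + C})`. -/
def IntrinsicRecovery.Recovers (R : IntrinsicRecovery.{u}) {n : ℕ} {M : Type u}
    [TopologicalSpace M] [ChartedSpace (EuclideanSpace ℝ (Fin n)) M] [IsManifold (𝓡 n) ∞ M]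
    (T : DistributionTuple n M) : Prop :=
  ∀ i, R.recover n M T.Δ T.C T.VC i = T.V i

/-- `Φ : M → S` is the projection onto the quotient manifold of `M` by the foliation whose leaves
are the maximal integral manifolds of `C`: a surjective submersion with connected fibres, tangent
to `C`. -/
structure IsLeafProjection {n m : ℕ} {M S : Type*} [TopologicalSpace M]
    [ChartedSpace (EuclideanSpace ℝ (Fin n)) M] [TopologicalSpace S]
    [ChartedSpace (EuclideanSpace ℝ (Fin m)) S] (C : PlaneField n M) (Φ : M → S) : Prop where
  smooth : ContMDiff (𝓡 n) (𝓡 m) ∞ Φ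
  surjective : Function.Surjective Φ
  submersion : ∀ x, Function.Surjective (mfderiv (𝓡 n) (𝓡 m) Φ x)
  ker_eq : ∀ x, (mfderiv (𝓡 n) (𝓡 m) Φ x).toLinearMap.ker = C x
  connected : ∀ γ : S, IsConnected (Φ ⁻¹' {γ})

/-- Families of subspaces of `T_γ S` indexed by `ℤ` (the flags are among them). -/
abbrev Flag (m : ℕ) {S : Type*} [TopologicalSpace S]
    [ChartedSpace (EuclideanSpace ℝ (Fin m)) S] (γ : S) :=
  ℤ → Submodule ℝ (TangentSpace (𝓡 m) γ)

/-- The data of a flag structure on `S`: a distribution `Δ` and, for each `γ`, a set `Y γ` of flags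
in the fibre of `Δ` at `γ`. -/
structure FlagStructure (m : ℕ) (S : Type*) [TopologicalSpace S]
    [ChartedSpace (EuclideanSpace ℝ (Fin m)) S] where
  Δ : PlaneField m S
  Y : ∀ γ : S, Set (Flag m γ)

/-- Two flag structures are equivalent: a diffeomorphism `φ` of the bases carries `Δ` to `Δ'` and
each `Y γ` (as a set of flags) onto `Y' (φ γ)`. -/
def FlagEquiv {m m' : ℕ} {S S' : Type*} [TopologicalSpace S]
    [ChartedSpace (EuclideanSpace ℝ (Fin m)) S] [TopologicalSpace S']
    [ChartedSpace (EuclideanSpace ℝ (Fin m')) S']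
    (𝓕 : FlagStructure m S) (𝓕' : FlagStructure m' S') : Prop :=
  ∃ φ : S ≃ₘ^∞⟮𝓡 m, 𝓡 m'⟯ S', Carries φ 𝓕.Δ 𝓕'.Δ ∧
    ∀ γ : S, (fun (Λ : Flag m γ) (i : ℤ) =>
      (Λ i).map (mfderiv (𝓡 m) (𝓡 m') φ γ).toLinearMap) '' 𝓕.Y γ = 𝓕'.Y (φ γ)

/-- The map `x ↦ (γ, Y^γ(x))`, where `γ = Φ x` is the leaf through `x` and
`Y^γ(x) = {Φ_* (V i x)}_{i ∈ ℤ}`. -/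
noncomputable def flagMap {n m : ℕ} {M S : Type*} [TopologicalSpace M]
    [ChartedSpace (EuclideanSpace ℝ (Fin n)) M] [TopologicalSpace S]
    [ChartedSpace (EuclideanSpace ℝ (Fin m)) S]
    (V : ℤ → PlaneField n M) (Φ : M → S) (x : M) : Σ γ : S, Flag m γ :=
  ⟨Φ x, fun i => (V i x).map (mfderiv (𝓡 n) (𝓡 m) Φ x).toLinearMap⟩

/-- The flag structure obtained from a tuple of distributions by the linearization procedure:
`Δ` is the push-forward of the distribution `T.Δ` (the supremum is over the subspaces
`Φ_* (T.Δ x)` of `T_γ S`, `x` in the leaf `γ`, which coincide when `[C, Δ] ⊆ Δ`), and `Y γ` is the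
image of the map `x ↦ Y^γ(x)` on the leaf `γ`. -/
noncomputable def linearization {n m : ℕ} {M S : Type*} [TopologicalSpace M]
    [ChartedSpace (EuclideanSpace ℝ (Fin n)) M] [IsManifold (𝓡 n) ∞ M] [TopologicalSpace S]
    [ChartedSpace (EuclideanSpace ℝ (Fin m)) S]
    (T : DistributionTuple n M) (Φ : M → S) : FlagStructure m S where
  Δ γ := sSup {P | ∃ x : M,
    (⟨Φ x, (T.Δ x).map (mfderiv (𝓡 n) (𝓡 m) Φ x).toLinearMap⟩ :
      Σ γ : S, Submodule ℝ (TangentSpace (𝓡 m) γ)) = ⟨γ, P⟩}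
  Y γ := {Λ | ∃ x : M, flagMap T.V Φ x = ⟨γ, Λ⟩}

/-- Convergence in the bundle over `S` whose fibre at `γ` consists of the flags in `T_γ S`: the base
points converge and, for each `i`, the `i`-th subspaces converge in the bundle of Grassmannians of
`T S`, i.e. they eventually have the dimension of the limit and every vector of the limit subspace
is a limit, in `T S`, of vectors of these subspaces. -/
def FlagTendsto {m : ℕ} {S : Type*} [TopologicalSpace S]
    [ChartedSpace (EuclideanSpace ℝ (Fin m)) S] [IsManifold (𝓡 m) ∞ S]
    (z : ℕ → Σ γ : S, Flag m γ) (z₀ : Σ γ : S, Flag m γ) : Prop :=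
  Filter.Tendsto (fun k => (z k).1) Filter.atTop (𝓝 z₀.1) ∧
  ∀ i : ℤ,
    (∀ᶠ k in Filter.atTop, Module.finrank ℝ ↥((z k).2 i) = Module.finrank ℝ ↥(z₀.2 i)) ∧
    ∀ v ∈ z₀.2 i, ∃ w : ∀ k, TangentSpace (𝓡 m) (z k).1, (∀ k, w k ∈ (z k).2 i) ∧
      Filter.Tendsto (fun k => (⟨(z k).1, w k⟩ : TangentBundle (𝓡 m) S)) Filter.atTop
        (𝓝 (⟨z₀.1, v⟩ : TangentBundle (𝓡 m) S))

/-- The sets `Y^γ` are submanifolds of the flag varieties, smoothly depending on `γ`, with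
`M → S` as their tautological bundle (whose fibre over `γ` consists of the points of `Y^γ`):
the map `x ↦ (Φ x, Y^{Φ x}(x))` is an embedding of `M` into the bundle of flags of `T S`. -/
structure IsTautological {n m : ℕ} {M S : Type*} [TopologicalSpace M]
    [ChartedSpace (EuclideanSpace ℝ (Fin n)) M] [TopologicalSpace S]
    [ChartedSpace (EuclideanSpace ℝ (Fin m)) S] [IsManifold (𝓡 m) ∞ S]
    (V : ℤ → PlaneField n M) (Φ : M → S) : Prop where
  injective : Function.Injective (flagMap (m := m) V Φ)
  /-- Immersion along each leaf `γ`: if a smooth curve `c` in `γ` has nonzero velocity at time `0`,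
  then so has the curve of flags `Λ t = Y^γ(c t)`.  (The velocity at `0` of a curve of subspaces
  `t ↦ L t` is the map `L 0 → T_γ S / L 0` which sends `v 0` to the class of `v' 0`, for all smooth
  curves `v` of vectors with `v t ∈ L t`.) -/
  immersion : ∀ (γ : S) (c : ℝ → M) (Λ : ℝ → Flag m γ), ContMDiff 𝓘(ℝ, ℝ) (𝓡 n) ∞ c →
    (∀ t, flagMap V Φ (c t) = ⟨γ, Λ t⟩) → mfderiv 𝓘(ℝ, ℝ) (𝓡 n) c 0 ≠ 0 →
    ∃ (i : ℤ) (v : ℝ → EuclideanSpace ℝ (Fin m)), ContDiff ℝ ∞ v ∧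
      (∀ t, (v t : TangentSpace (𝓡 m) γ) ∈ Λ t i) ∧
      (deriv v 0 : TangentSpace (𝓡 m) γ) ∉ Λ 0 i
  /-- Homeomorphism onto the image. -/
  embedding : ∀ (x : ℕ → M) (x₀ : M),
    FlagTendsto (m := m) (fun k => flagMap V Φ (x k)) (flagMap V Φ x₀) →
    Filter.Tendsto x Filter.atTop (𝓝 x₀)

end FlagLinearization

/-!
The two directions are of different nature.

*From tuples to flag structures.* A diffeomorphism `F` carrying `C` to `C'` maps leaves to leaves:
the differential of `Φ' ∘ F` kills `C = ker dΦ`, so `Φ' ∘ F` is constant on the connected fibres of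
`Φ` and descends to a diffeomorphism `φ` of the leaf spaces (`exists_base_diffeomorph`). The
push-forward of flags is functorial (`pushFlag_comp`), so `φ` carries the one flag structure to the
other.

*From flag structures to tuples.* An equivalence `φ` of the flag structures maps the image of the
flag map of `M` onto that of `M'`. The flag maps being injective, this defines a bijection
`F : M → M'` which intertwines them, and `F` covers `φ`. It is continuous since the flag map of `M`
is continuous (`flagTendsto_flagMap`) and that of `M'` is a homeomorphism onto its image. It is
smooth since the flag map of `M'` is an immersion, hence has smooth local left inverses
(`contMDiff_of_flagMap_eq`). Then `F` carries `C` to `C'`, because `F` covers `φ`, and it carries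
`Δ` to `Δ'` and `V i + C` to `V' i + C'`, because these fields contain the leaf directions and are
therefore determined by their push-forwards (`carries_of_flagMap_eq`). The naturality of the
recovery procedure gives `V i` and `V' i`.

The bundle of flags is replaced by a vector space: a subspace of `ℝ^m` is encoded by the orthogonal
projection `P` onto it, which is a smooth function of a frame (`contDiffAt_starProjection_span`).
In these terms a vector curve `v t` lies in the subspace if and only if `P v = v`; differentiating
this turns the immersion condition on `Λ` into the injectivity of the differential of `x ↦ P x`
(`IsTautological.eq_zero_of_vderiv_eq_zero`).

The push-forward of `Δ` is a single subspace at each point of the leaf space because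
`[C, Δ] ⊆ Δ` (`map_mfderiv_eq_of_fibre`). In coordinates straightening `Φ`, the fields `P(·) u` with
`u` constant are sections of `Δ`, and their brackets with the constant fibre fields are the
derivatives `P' u`. Thus `P' = P P'`, which forces `P' = 0` for a family of orthogonal projections
(`eq_zero_of_isSymmetric_of_comp_eq`); no ordinary differential equation has to be solved.
-/

open Filter

namespace FlagLinearization

/-! ### Orthogonal projections onto the span of a frame -/

section Projections

variable {E : Type*} [NormedAddCommGroup E] [InnerProductSpace ℝ E]

/-- The linear combination map `c ↦ ∑ j, c j • f j`, depending linearly on the frame `f`. -/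
noncomputable def frameMap (k : ℕ) : (Fin k → E) →L[ℝ] ((Fin k → ℝ) →L[ℝ] E) :=
  ∑ j, (ContinuousLinearMap.smulRightL ℝ (Fin k → ℝ) E (ContinuousLinearMap.proj j)).comp
    (ContinuousLinearMap.proj j)

theorem frameMap_apply {k : ℕ} (f : Fin k → E) (c : Fin k → ℝ) :
    frameMap k f c = ∑ j, c j • f j := by
  simp [frameMap]

/-- If the derivative `P'` of a family of orthogonal projections (a symmetric operator satisfying
the derivative of `P² = P`) takes its values in the image of `P`, it vanishes: `P P' = P'` turns
`P' P + P P' = P'` into `P' P = 0`, whose transpose is `P' = P P' = 0`. -/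
theorem eq_zero_of_isSymmetric_of_comp_eq {P D : E →L[ℝ] E}
    (hP : P.toLinearMap.IsSymmetric) (hD : D.toLinearMap.IsSymmetric)
    (hPD : D.comp P + P.comp D = D) (h : P.comp D = D) : D = 0 := by
  have h0 : D.comp P = 0 := by rwa [h, add_eq_right] at hPD
  ext1 v
  rw [← h, zero_apply]
  refine ext_inner_right ℝ fun w => ?_
  have h1 : inner ℝ (P (D v)) w = inner ℝ (D v) (P w) := hP (D v) w
  have h2 : inner ℝ (D v) (P w) = inner ℝ v (D (P w)) := hD v (P w)
  have h3 : D (P w) = 0 := by simpa using congrArg (fun L => L w) h0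
  rw [ContinuousLinearMap.comp_apply, h1, h2, h3, inner_zero_right, inner_zero_left]

variable [FiniteDimensional ℝ E]

/-- The map `v ↦ (⟪f j, v⟫)_j`, the transpose of `frameMap k f`, depending linearly on `f`. -/
noncomputable def frameTranspose (k : ℕ) : (Fin k → E) →L[ℝ] (E →L[ℝ] (Fin k → ℝ)) :=
  LinearMap.toContinuousLinearMap
    { toFun := fun f => ContinuousLinearMap.pi fun j => innerSL ℝ (f j)
      map_add' := fun f g => by ext v j; simp
      map_smul' := fun a f => by ext v j; simp }

theorem frameTranspose_apply {k : ℕ} (f : Fin k → E) (v : E) (j : Fin k) :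
    frameTranspose k f v j = inner ℝ (f j) v := rfl

theorem gram_bijective {k : ℕ} {f : Fin k → E} (hf : LinearIndependent ℝ f) :
    Function.Bijective ((frameTranspose k f).comp (frameMap k f)) := by
  have hinj : Function.Injective ((frameTranspose k f).comp (frameMap k f)).toLinearMap := by
    rw [← LinearMap.ker_eq_bot, LinearMap.ker_eq_bot']
    intro c hc
    have h0 : ∀ j, inner ℝ (f j) (frameMap k f c) = 0 := fun j => congrFun hc j
    have h1 : frameMap k f c = 0 := by
      rw [← inner_self_eq_zero (𝕜 := ℝ)]
      nth_rewrite 1 [frameMap_apply]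
      simp [sum_inner, inner_smul_left, h0]
    rw [frameMap_apply] at h1
    exact funext (Fintype.linearIndependent_iff.1 hf c h1)
  exact ⟨hinj, (LinearMap.injective_iff_surjective).1 hinj⟩

/-- With `B` the matrix of a frame, the orthogonal projection onto its span is
`B (Bᵀ B)⁻¹ Bᵀ`. -/
theorem starProjection_span_eq {k : ℕ} {f : Fin k → E} (hf : LinearIndependent ℝ f) :
    (Submodule.span ℝ (Set.range f)).starProjection =
      (frameMap k f).comp ((((frameTranspose k f).comp (frameMap k f)).inverse).comp
        (frameTranspose k f)) := by
  set G := (frameTranspose k f).comp (frameMap k f) with hG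
  let e : (Fin k → ℝ) ≃L[ℝ] (Fin k → ℝ) :=
    (LinearEquiv.ofBijective G.toLinearMap (gram_bijective hf)).toContinuousLinearEquiv
  have he : G = (e : (Fin k → ℝ) →L[ℝ] (Fin k → ℝ)) := by ext; rfl
  rw [he, ContinuousLinearMap.inverse_equiv]
  ext1 v
  refine Submodule.eq_starProjection_of_mem_of_inner_eq_zero ?_ ?_
  · simp only [ContinuousLinearMap.comp_apply, frameMap_apply]
    exact Submodule.sum_mem _ fun j _ => Submodule.smul_mem _ _ (Submodule.subset_span ⟨j, rfl⟩)
  · intro w hw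
    have key : ∀ j, inner ℝ (f j) (v - (frameMap k f) (e.symm (frameTranspose k f v))) = 0 := by
      intro j
      have h1 : G (e.symm (frameTranspose k f v)) = frameTranspose k f v := by
        rw [he]; exact e.apply_symm_apply _
      have h2 := congrFun h1 j
      simp only [hG, ContinuousLinearMap.comp_apply, frameTranspose_apply] at h2
      rw [inner_sub_right, h2, sub_self]
    induction hw using Submodule.span_induction with
    | mem x hx => obtain ⟨j, rfl⟩ := hx; rw [real_inner_comm]; exact key j
    | zero => simp
    | add x y _ _ hx hy => rw [inner_add_right, hx, hy, add_zero]
    | smul a x _ hx => rw [inner_smul_right, hx, mul_zero]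

/-- The orthogonal projection onto the span of a frame is a smooth function of the frame. -/
theorem contDiffAt_starProjection_span {k : ℕ} {f : Fin k → E} (hf : LinearIndependent ℝ f) :
    ContDiffAt ℝ ∞ (fun f : Fin k → E => (Submodule.span ℝ (Set.range f)).starProjection) f := by
  have hev : (fun f : Fin k → E => (Submodule.span ℝ (Set.range f)).starProjection) =ᶠ[𝓝 f]
      fun f => (frameMap k f).comp ((((frameTranspose k f).comp (frameMap k f)).inverse).comp
        (frameTranspose k f)) := by
    filter_upwards [hf.eventually] with g hg using starProjection_span_eq hg
  refine ContDiffAt.congr_of_eventuallyEq ?_ hev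
  let e : (Fin k → ℝ) ≃L[ℝ] (Fin k → ℝ) := (LinearEquiv.ofBijective
    ((frameTranspose k f).comp (frameMap k f)).toLinearMap
      (gram_bijective hf)).toContinuousLinearEquiv
  have he : (frameTranspose k f).comp (frameMap k f) = (e : (Fin k → ℝ) →L[ℝ] (Fin k → ℝ)) := by
    ext; rfl
  have hB : ContDiffAt ℝ ∞ (fun f : Fin k → E => frameMap k f) f :=
    (frameMap (E := E) k).contDiff.contDiffAt
  have hT : ContDiffAt ℝ ∞ (fun f : Fin k → E => frameTranspose k f) f :=
    (frameTranspose (E := E) k).contDiff.contDiffAt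
  have hinv : ContDiffAt ℝ ∞
      (fun f : Fin k → E => ((frameTranspose k f).comp (frameMap k f)).inverse) f := by
    refine ContDiffAt.comp (g := ContinuousLinearMap.inverse) f ?_ (hT.clm_comp hB)
    rw [he]
    exact contDiffAt_map_inverse e
  exact hB.clm_comp (hinv.clm_comp hT)

end Projections

/-! ### Images of distributions -/

/-- A continuous family of spanning tuples whose spans have locally constant dimension contains,
locally, a subfamily which is a frame: a basis at one point stays independent nearby. -/
theorem exists_subframe {X E : Type*} [TopologicalSpace X] [NormedAddCommGroup E]
    [NormedSpace ℝ E] [FiniteDimensional ℝ E] {k : ℕ} {Y : X → Fin k → E} {x₀ : X}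
    (hY : ContinuousAt Y x₀)
    (hrank : ∀ᶠ x in 𝓝 x₀, Module.finrank ℝ (Submodule.span ℝ (Set.range (Y x))) =
      Module.finrank ℝ (Submodule.span ℝ (Set.range (Y x₀)))) :
    ∃ (r : ℕ) (ι : Fin r → Fin k), ∀ᶠ x in 𝓝 x₀, LinearIndependent ℝ (Y x ∘ ι) ∧
      Submodule.span ℝ (Set.range (Y x ∘ ι)) = Submodule.span ℝ (Set.range (Y x)) := by
  obtain ⟨f, hf, hspan, hli⟩ := Submodule.exists_fun_fin_finrank_span_eq ℝ (Set.range (Y x₀))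
  choose ι hι using hf
  have hf' : Y x₀ ∘ ι = f := funext hι
  refine ⟨_, ι, ?_⟩
  have hc : ContinuousAt (fun x => Y x ∘ ι) x₀ :=
    continuousAt_pi.2 fun j => (continuousAt_pi.1 hY) (ι j)
  have hev : ∀ᶠ g in 𝓝 (Y x₀ ∘ ι), LinearIndependent ℝ g := by
    rw [hf']; exact hli.eventually
  filter_upwards [hc.eventually hev, hrank] with x hx hr
  refine ⟨hx, Submodule.eq_of_le_of_finrank_eq ?_ ?_⟩
  · exact Submodule.span_mono (Set.range_comp_subset_range ι (Y x))
  · rw [finrank_span_eq_card hx, hr, Fintype.card_fin]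

variable {n : ℕ} {M : Type*} [TopologicalSpace M]
  [ChartedSpace (EuclideanSpace ℝ (Fin n)) M]

/-- The differential of a map to a vector space, as a map to that fixed vector space. -/
noncomputable def vderiv {E : Type*} [NormedAddCommGroup E] [NormedSpace ℝ E]
    (g : M → E) (x : M) : TangentSpace (𝓡 n) x →L[ℝ] E :=
  mfderiv (𝓡 n) 𝓘(ℝ, E) g x

/-- The image `dg (D x)` of a field of subspaces under a map `g` to a vector space, as a subspace
of that fixed vector space. -/
noncomputable def imageField {E : Type*} [NormedAddCommGroup E] [NormedSpace ℝ E]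
    (g : M → E) (D : PlaneField n M) (x : M) : Submodule ℝ E :=
  (D x).map (vderiv g x).toLinearMap

/-- The orthogonal projection onto `imageField g D x`; it encodes this subspace by a point of a
fixed vector space. -/
noncomputable def imageProj {E : Type*} [NormedAddCommGroup E] [InnerProductSpace ℝ E]
    [FiniteDimensional ℝ E] (g : M → E) (D : PlaneField n M) (x : M) : E →L[ℝ] E :=
  (imageField g D x).starProjection

theorem imageField_eq_span {E : Type*} [NormedAddCommGroup E] [NormedSpace ℝ E] {g : M → E}
    {D : PlaneField n M} {x : M} {k : ℕ} {X : Fin k → TangentSpace (𝓡 n) x}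
    (h : Submodule.span ℝ (Set.range X) = D x) :
    imageField g D x =
      Submodule.span ℝ (Set.range fun j => vderiv g x (X j)) := by
  unfold imageField
  rw [← h, Submodule.map_span, ← Set.range_comp]
  rfl

variable [IsManifold (𝓡 n) ∞ M]

theorem IsSmoothFieldOn.contMDiffOn_vderiv_apply {E : Type*} [NormedAddCommGroup E]
    [NormedSpace ℝ E] {X : ∀ x : M, TangentSpace (𝓡 n) x} {U : Set M} (hU : IsOpen U)
    (hX : IsSmoothFieldOn X U) {g : M → E} (hg : ContMDiffOn (𝓡 n) 𝓘(ℝ, E) ∞ g U) :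
    ContMDiffOn (𝓡 n) 𝓘(ℝ, E) ∞ (fun x => vderiv g x (X x)) U := by
  have : IsManifold (𝓡 n) 1 M := IsManifold.of_le (n := ∞) (by norm_cast)
  have h1 := hg.contMDiffOn_tangentMapWithin (m := ∞) (by rfl) hU.uniqueMDiffOn
  have h2 := h1.comp hX (fun x hx => hx)
  have h3 := (contMDiff_snd_tangentBundle_modelSpace E 𝓘(ℝ, E) (n := ∞)).comp_contMDiffOn h2
  refine h3.congr fun x hx => ?_
  simp only [Function.comp, tangentMapWithin, vderiv]
  rw [mfderivWithin_of_isOpen hU hx]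
  rfl

/-- If a distribution has an image of locally constant rank, the orthogonal projection onto this
image varies smoothly. -/
theorem IsDistribution.contMDiffAt_imageProj {E : Type*} [NormedAddCommGroup E]
    [InnerProductSpace ℝ E] [FiniteDimensional ℝ E] {D : PlaneField n M} (hD : IsDistribution D)
    {g : M → E} {U : Set M} (hU : IsOpen U) (hg : ContMDiffOn (𝓡 n) 𝓘(ℝ, E) ∞ g U) {x₀ : M}
    (hx₀ : x₀ ∈ U)
    (hrank : ∀ᶠ x in 𝓝 x₀, Module.finrank ℝ (imageField g D x) =
      Module.finrank ℝ (imageField g D x₀)) :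
    ContMDiffAt (𝓡 n) 𝓘(ℝ, E →L[ℝ] E) ∞ (imageProj g D) x₀ := by
  obtain ⟨U', hU', hx₀', k, X, hX, hspan⟩ := hD x₀
  have hUU : IsOpen (U ∩ U') := hU.inter hU'
  have hmem : U ∩ U' ∈ 𝓝 x₀ := hUU.mem_nhds ⟨hx₀, hx₀'⟩
  let Y : M → Fin k → E := fun x j => vderiv g x (X j x)
  have hYj : ∀ j, ContMDiffAt (𝓡 n) 𝓘(ℝ, E) ∞ (fun x => Y x j) x₀ := fun j =>
    (IsSmoothFieldOn.contMDiffOn_vderiv_apply hUU ((hX j).mono Set.inter_subset_right)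
      (hg.mono Set.inter_subset_left)).contMDiffAt hmem
  have himg : ∀ x ∈ U', imageField g D x = Submodule.span ℝ (Set.range (Y x)) := fun x hx =>
    imageField_eq_span (hspan x hx).2
  have hYc : ContinuousAt Y x₀ := continuousAt_pi.2 fun j => (hYj j).continuousAt
  obtain ⟨r, ι, hι⟩ := exists_subframe hYc (by
    filter_upwards [hrank, hU'.mem_nhds hx₀'] with x hx hxU
    rwa [himg x hxU, himg x₀ hx₀'] at hx)
  have hs : ContMDiffAt (𝓡 n) 𝓘(ℝ, E →L[ℝ] E) ∞
      (fun x => (Submodule.span ℝ (Set.range (Y x ∘ ι))).starProjection) x₀ :=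
    ContDiffAt.comp_contMDiffAt (g := fun f : Fin r → E =>
      (Submodule.span ℝ (Set.range f)).starProjection) (f := fun x => Y x ∘ ι)
      (contDiffAt_starProjection_span hι.self_of_nhds.1)
      (contMDiffAt_pi_space.2 fun j => hYj (ι j))
  refine hs.congr_of_eventuallyEq ?_
  filter_upwards [hι, hU'.mem_nhds hx₀'] with x hx hxU
  simp only [imageProj, himg x hxU, hx.2]

theorem IsDistribution.eventually_finrank_eq {D : PlaneField n M} (hD : IsDistribution D)
    (x₀ : M) : ∀ᶠ x in 𝓝 x₀, Module.finrank ℝ (D x) = Module.finrank ℝ (D x₀) := by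
  obtain ⟨U, hU, hx₀, k, X, -, hspan⟩ := hD x₀
  have key : ∀ x ∈ U, Module.finrank ℝ (D x) = k := fun x hx => by
    rw [← (hspan x hx).2, finrank_span_eq_card (hspan x hx).1, Fintype.card_fin]
  filter_upwards [hU.mem_nhds hx₀] with x hx
  rw [key x hx, key x₀ hx₀]

theorem finrank_map_add_finrank_inf_ker {V W : Type*} [AddCommGroup V] [Module ℝ V]
    [FiniteDimensional ℝ V] [AddCommGroup W] [Module ℝ W] (A : V →ₗ[ℝ] W) (p : Submodule ℝ V) :
    Module.finrank ℝ (p.map A) + Module.finrank ℝ (p ⊓ A.ker : Submodule ℝ V) =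
      Module.finrank ℝ p := by
  have h := LinearMap.finrank_range_add_finrank_ker (A.domRestrict p)
  rw [LinearMap.range_domRestrict, LinearMap.ker_domRestrict] at h
  rw [← h]
  congr 1
  rw [inf_comm]
  rw [← Submodule.finrank_map_subtype_eq p, Submodule.map_comap_subtype, inf_comm]

/-! ### Straightening a submersion -/

section Charts

variable {m : ℕ} {S : Type*} [TopologicalSpace S]
  [ChartedSpace (EuclideanSpace ℝ (Fin m)) S] [IsManifold (𝓡 m) ∞ S]

theorem contMDiffOn_chartAt (s₀ : S) : ContMDiffOn (𝓡 m) (𝓡 m) ∞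
    (chartAt (EuclideanSpace ℝ (Fin m)) s₀) (chartAt (EuclideanSpace ℝ (Fin m)) s₀).source :=
  contMDiffOn_chart

theorem vderiv_chartAt_injective {s₀ s : S}
    (hs : s ∈ (chartAt (EuclideanSpace ℝ (Fin m)) s₀).source) :
    Function.Injective (vderiv (n := m) (chartAt (EuclideanSpace ℝ (Fin m)) s₀) s) := by
  have : IsManifold (𝓡 m) 1 S := IsManifold.of_le (n := ∞) (by norm_cast)
  exact (mdifferentiable_chart (I := 𝓡 m) s₀).mfderiv_injective hs

variable {n : ℕ} {M : Type*} [TopologicalSpace M]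
  [ChartedSpace (EuclideanSpace ℝ (Fin n)) M]

omit [IsManifold (𝓡 m) ∞ S] in
theorem vderiv_comp {E : Type*} [NormedAddCommGroup E] [NormedSpace ℝ E] {g : S → E} {Φ : M → S}
    {x : M} (hg : MDifferentiableAt (𝓡 m) 𝓘(ℝ, E) g (Φ x))
    (hΦ : MDifferentiableAt (𝓡 n) (𝓡 m) Φ x) (w : TangentSpace (𝓡 n) x) :
    vderiv (g ∘ Φ) x w = vderiv g (Φ x) (mfderiv (𝓡 n) (𝓡 m) Φ x w) := by
  unfold vderiv
  rw [mfderiv_comp x hg hΦ]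
  rfl

theorem mdifferentiableAt_chartAt {s₀ s : S}
    (hs : s ∈ (chartAt (EuclideanSpace ℝ (Fin m)) s₀).source) :
    MDifferentiableAt (𝓡 m) (𝓡 m) (chartAt (EuclideanSpace ℝ (Fin m)) s₀) s :=
  ((contMDiffOn_chartAt s₀).contMDiffAt
    ((chartAt (EuclideanSpace ℝ (Fin m)) s₀).open_source.mem_nhds hs)).mdifferentiableAt (by simp)

end Charts

/-- Straightening coordinates `e` of the map `Φ` near `x₀`: a chart (smooth in both directions) in
which `Φ`, read in the preferred chart at `Φ x₀`, is the linear surjection `ℓ`. -/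
structure IsStraightening {n m : ℕ} {M S : Type*} [TopologicalSpace M]
    [ChartedSpace (EuclideanSpace ℝ (Fin n)) M] [TopologicalSpace S]
    [ChartedSpace (EuclideanSpace ℝ (Fin m)) S] (Φ : M → S) (x₀ : M)
    (e : OpenPartialHomeomorph M (EuclideanSpace ℝ (Fin n)))
    (ℓ : EuclideanSpace ℝ (Fin n) →L[ℝ] EuclideanSpace ℝ (Fin m)) : Prop where
  mem_source : x₀ ∈ e.source
  contMDiffOn : ContMDiffOn (𝓡 n) (𝓡 n) ∞ e e.source
  contMDiffOn_symm : ContMDiffOn (𝓡 n) (𝓡 n) ∞ e.symm e.target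
  mem_chart_source : ∀ x ∈ e.source, Φ x ∈ (chartAt (EuclideanSpace ℝ (Fin m)) (Φ x₀)).source
  chart_eq : ∀ x ∈ e.source, chartAt (EuclideanSpace ℝ (Fin m)) (Φ x₀) (Φ x) = ℓ (e x)
  surjective : Function.Surjective ℓ

/-- Local linearization of a map `f` between vector spaces with surjective differential: if `R` is
a right inverse of `f'(p₀)`, then `G p = p + R (f p - f'(p₀) p)` has derivative `id` at `p₀`, and
`f'(p₀) ∘ G = f`. -/
theorem exists_linearizing_openPartialHomeomorph {E F : Type*} [NormedAddCommGroup E]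
    [NormedSpace ℝ E] [FiniteDimensional ℝ E] [NormedAddCommGroup F] [NormedSpace ℝ F]
    [FiniteDimensional ℝ F] {f : E → F} {O : Set E} (hO : IsOpen O) (hf : ContDiffOn ℝ ∞ f O)
    {p₀ : E} (hp₀ : p₀ ∈ O) (hsurj : Function.Surjective (fderiv ℝ f p₀)) :
    ∃ H : OpenPartialHomeomorph E E, p₀ ∈ H.source ∧ H.source ⊆ O ∧ ContDiffOn ℝ ∞ H H.source ∧
      ContDiffOn ℝ ∞ H.symm H.target ∧ ∀ p, fderiv ℝ f p₀ (H p) = f p := by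
  obtain ⟨R, hR⟩ := (fderiv ℝ f p₀).toLinearMap.exists_rightInverse_of_surjective
    (LinearMap.range_eq_top.2 hsurj)
  have hR' : ∀ v, fderiv ℝ f p₀ (R v) = v := fun v => LinearMap.congr_fun hR v
  let R' : F →L[ℝ] E := R.toContinuousLinearMap
  let G : E → E := fun p => p + R' (f p - fderiv ℝ f p₀ p)
  have hG : ContDiffOn ℝ ∞ G O := contDiffOn_id.add
    (R'.contDiff.comp_contDiffOn (hf.sub (fderiv ℝ f p₀).contDiff.contDiffOn))
  have hGat : ContDiffAt ℝ ∞ G p₀ := hG.contDiffAt (hO.mem_nhds hp₀)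
  have hf' : HasFDerivAt f (fderiv ℝ f p₀) p₀ :=
    ((hf.contDiffAt (hO.mem_nhds hp₀)).differentiableAt (by simp)).hasFDerivAt
  have hG' : HasFDerivAt G ((ContinuousLinearEquiv.refl ℝ E : E ≃L[ℝ] E) : E →L[ℝ] E) p₀ := by
    have h1 := (hasFDerivAt_id p₀).add
      (R'.hasFDerivAt.comp p₀ (hf'.sub (fderiv ℝ f p₀).hasFDerivAt))
    refine h1.congr_fderiv ?_
    ext v
    simp
  let H₀ := hGat.toOpenPartialHomeomorph G hG' (by simp)
  have hH₀ : ∀ p, H₀ p = G p := fun p => rfl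
  let inv : Set (E →L[ℝ] E) := Set.range ((↑) : (E ≃L[ℝ] E) → E →L[ℝ] E)
  have hcont : ContinuousOn (fderiv ℝ G) O := hG.continuousOn_fderiv_of_isOpen hO (by simp)
  have hO' : IsOpen (O ∩ fderiv ℝ G ⁻¹' inv) :=
    hcont.isOpen_inter_preimage hO ContinuousLinearEquiv.isOpen
  refine ⟨H₀.restrOpen _ hO', ⟨hGat.mem_toOpenPartialHomeomorph_source hG' (by simp), hp₀, ?_⟩,
    ?_, ?_, ?_, ?_⟩
  · exact ⟨_, hG'.fderiv.symm⟩
  · exact fun p hp => hp.2.1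
  · exact hG.mono fun p hp => hp.2.1
  · intro q hq
    have hq' := (H₀.restrOpen _ hO').map_target hq
    obtain ⟨A, hA⟩ := hq'.2.2
    refine ((H₀.restrOpen _ hO').contDiffAt_symm (f₀' := A) hq ?_ ?_).contDiffWithinAt
    · rw [hA]
      exact ((hG.contDiffAt (hO.mem_nhds hq'.2.1)).differentiableAt (by simp)).hasFDerivAt
    · exact hG.contDiffAt (hO.mem_nhds hq'.2.1)
  · intro p
    change fderiv ℝ f p₀ (p + R (f p - fderiv ℝ f p₀ p)) = f p
    rw [map_add, hR', add_sub_cancel]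

variable {n m : ℕ} {M S : Type*} [TopologicalSpace M]
  [ChartedSpace (EuclideanSpace ℝ (Fin n)) M] [IsManifold (𝓡 n) ∞ M] [TopologicalSpace S]
  [ChartedSpace (EuclideanSpace ℝ (Fin m)) S] [IsManifold (𝓡 m) ∞ S]

theorem exists_isStraightening {Φ : M → S} (hΦ : ContMDiff (𝓡 n) (𝓡 m) ∞ Φ) (x₀ : M)
    (hsub : Function.Surjective (mfderiv (𝓡 n) (𝓡 m) Φ x₀)) :
    ∃ (e : OpenPartialHomeomorph M (EuclideanSpace ℝ (Fin n)))
      (ℓ : EuclideanSpace ℝ (Fin n) →L[ℝ] EuclideanSpace ℝ (Fin m)),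
      IsStraightening Φ x₀ e ℓ := by
  have : IsManifold (𝓡 n) 1 M := IsManifold.of_le (n := ∞) (by norm_cast)
  have : IsManifold (𝓡 m) 1 S := IsManifold.of_le (n := ∞) (by norm_cast)
  set e₀ := chartAt (EuclideanSpace ℝ (Fin n)) x₀ with he₀
  set c := chartAt (EuclideanSpace ℝ (Fin m)) (Φ x₀) with hc
  let f : EuclideanSpace ℝ (Fin n) → EuclideanSpace ℝ (Fin m) := c ∘ Φ ∘ e₀.symm
  let O := e₀.target ∩ e₀.symm ⁻¹' (Φ ⁻¹' c.source)
  have hO : IsOpen O :=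
    e₀.symm.isOpen_inter_preimage (c.open_source.preimage hΦ.continuous)
  have hx₀ : x₀ ∈ e₀.source := mem_chart_source _ x₀
  have hp₀ : e₀ x₀ ∈ O := by
    refine ⟨e₀.map_source hx₀, ?_⟩
    rw [Set.mem_preimage, e₀.left_inv hx₀]
    exact mem_chart_source _ (Φ x₀)
  have hf : ContDiffOn ℝ ∞ f O := by
    rw [← contMDiffOn_iff_contDiffOn]
    refine (contMDiffOn_chartAt (Φ x₀)).comp
      (hΦ.comp_contMDiffOn (contMDiffOn_chart_symm.mono Set.inter_subset_left)) ?_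
    exact fun p hp => hp.2
  have hsurj : Function.Surjective (fderiv ℝ f (e₀ x₀)) := by
    have hd1 := (mdifferentiable_chart (I := 𝓡 n) x₀)
    have hd2 := (mdifferentiable_chart (I := 𝓡 m) (Φ x₀))
    have hy : (e₀.symm (e₀ x₀)) = x₀ := e₀.left_inv hx₀
    have hS1 : MDifferentiableAt (𝓡 n) (𝓡 n) e₀.symm (e₀ x₀) :=
      hd1.mdifferentiableAt_symm (e₀.map_source hx₀)
    have hS2 : MDifferentiableAt (𝓡 n) (𝓡 m) Φ (e₀.symm (e₀ x₀)) :=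
      hΦ.mdifferentiable (by simp) _
    have hS3 : MDifferentiableAt (𝓡 m) (𝓡 m) c (Φ (e₀.symm (e₀ x₀))) := by
      rw [hy]; exact hd2.mdifferentiableAt (mem_chart_source _ _)
    rw [← mfderiv_eq_fderiv]
    have hcomp : mfderiv (𝓡 n) (𝓡 m) f (e₀ x₀) = (mfderiv (𝓡 m) (𝓡 m) c _).comp
        ((mfderiv (𝓡 n) (𝓡 m) Φ _).comp (mfderiv (𝓡 n) (𝓡 n) e₀.symm (e₀ x₀))) := by
      rw [← mfderiv_comp _ hS2 hS1]
      exact mfderiv_comp _ hS3 (hS2.comp _ hS1)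
    rw [hcomp]
    refine Function.Surjective.comp (g := mfderiv (𝓡 m) (𝓡 m) c _) ?_
      (Function.Surjective.comp (g := mfderiv (𝓡 n) (𝓡 m) Φ _) ?_ ?_)
    · rw [hy]; exact hd2.mfderiv_surjective (mem_chart_source _ _)
    · rw [hy]; exact hsub
    · exact hd1.symm.mfderiv_surjective (e₀.map_source hx₀)
  obtain ⟨H, hpH, hHO, hH, hH', hHf⟩ := exists_linearizing_openPartialHomeomorph hO hf hp₀ hsurj
  refine ⟨e₀.trans H, fderiv ℝ f (e₀ x₀), ⟨?_, ?_, ?_, ?_, ?_, hsurj⟩⟩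
  · rw [OpenPartialHomeomorph.trans_source]; exact ⟨hx₀, hpH⟩
  · rw [OpenPartialHomeomorph.trans_source]
    exact (contMDiffOn_iff_contDiffOn.2 hH).comp
      (contMDiffOn_chart.mono Set.inter_subset_left) fun x hx => hx.2
  · rw [OpenPartialHomeomorph.trans_target]
    exact contMDiffOn_chart_symm.comp
      ((contMDiffOn_iff_contDiffOn.2 hH').mono Set.inter_subset_left) fun x hx => hx.2
  · intro x hx
    rw [OpenPartialHomeomorph.trans_source] at hx
    have := (hHO hx.2).2
    rwa [Set.mem_preimage, e₀.left_inv hx.1] at this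
  · intro x hx
    rw [OpenPartialHomeomorph.trans_source] at hx
    have : f (e₀ x) = c (Φ x) := by simp only [f, Function.comp, e₀.left_inv hx.1]
    rw [← this, ← hHf]
    rfl

namespace IsStraightening

variable {Φ : M → S} {x₀ : M} {e : OpenPartialHomeomorph M (EuclideanSpace ℝ (Fin n))}
  {ℓ : EuclideanSpace ℝ (Fin n) →L[ℝ] EuclideanSpace ℝ (Fin m)}

omit [IsManifold (𝓡 m) ∞ S] [IsManifold (𝓡 n) ∞ M] in
theorem mdifferentiable (h : IsStraightening Φ x₀ e ℓ) : e.MDifferentiable (𝓡 n) (𝓡 n) :=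
  ⟨h.contMDiffOn.mdifferentiableOn (by simp), h.contMDiffOn_symm.mdifferentiableOn (by simp)⟩

omit [IsManifold (𝓡 n) ∞ M] in
theorem vderiv_chart_comp (h : IsStraightening Φ x₀ e ℓ) (hΦ : ContMDiff (𝓡 n) (𝓡 m) ∞ Φ) {x : M}
    (hx : x ∈ e.source) (w : TangentSpace (𝓡 n) x) :
    vderiv (chartAt (EuclideanSpace ℝ (Fin m)) (Φ x₀)) (Φ x) (mfderiv (𝓡 n) (𝓡 m) Φ x w) =
      ℓ (vderiv e x w) := by
  rw [← vderiv_comp (mdifferentiableAt_chartAt (h.mem_chart_source x hx))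
    (hΦ.mdifferentiable (by simp) x)]
  have hev : (chartAt (EuclideanSpace ℝ (Fin m)) (Φ x₀)) ∘ Φ =ᶠ[𝓝 x] ℓ ∘ e := by
    filter_upwards [e.open_source.mem_nhds hx] with y hy using h.chart_eq y hy
  have h1 : mfderiv (𝓡 n) (𝓡 m) (ℓ ∘ e) x =
      (mfderiv (𝓡 n) (𝓡 m) ℓ (e x)).comp (mfderiv (𝓡 n) (𝓡 n) e x) :=
    mfderiv_comp x ℓ.differentiableAt.mdifferentiableAt (h.mdifferentiable.mdifferentiableAt hx)
  unfold vderiv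
  rw [hev.mfderiv_eq, h1, mfderiv_eq_fderiv, ℓ.fderiv]
  rfl

omit [IsManifold (𝓡 n) ∞ M] in
theorem mfderiv_eq_zero_iff (h : IsStraightening Φ x₀ e ℓ) (hΦ : ContMDiff (𝓡 n) (𝓡 m) ∞ Φ)
    {x : M} (hx : x ∈ e.source) (w : TangentSpace (𝓡 n) x) :
    mfderiv (𝓡 n) (𝓡 m) Φ x w = 0 ↔ ℓ (vderiv e x w) = 0 := by
  rw [← h.vderiv_chart_comp hΦ hx w]
  exact (map_eq_zero_iff _ (vderiv_chartAt_injective (h.mem_chart_source x hx))).symm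

end IsStraightening

/-! ### Functions constant along the fibres, curves in the fibres, and local sections -/

/-- A function which has the same value as at `x₀` on the points of the fibre through `x₀` that are
close to `x₀`, for every `x₀`, is constant on connected fibres. -/
theorem eq_of_eventually_eq_on_fibre {M S Z : Type*} [TopologicalSpace M] {Φ : M → S}
    (hconn : ∀ γ : S, IsConnected (Φ ⁻¹' {γ}))
    {h : M → Z} (hloc : ∀ x₀, ∀ᶠ x in 𝓝 x₀, Φ x = Φ x₀ → h x = h x₀) {x y : M}
    (hxy : Φ x = Φ y) : h x = h y := by
  have hpre : PreconnectedSpace (Φ ⁻¹' {Φ y}) :=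
    isPreconnected_iff_preconnectedSpace.1 (hconn (Φ y)).isPreconnected
  have hlc : IsLocallyConstant (fun z : Φ ⁻¹' {Φ y} => h z) := by
    rw [IsLocallyConstant.iff_eventually_eq]
    intro z
    have := continuous_subtype_val.continuousAt.eventually (hloc z)
    filter_upwards [this] with z' hz'
    exact hz' (by rw [show Φ z' = Φ y from z'.2, show Φ z = Φ y from z.2])
  exact hlc.apply_eq_of_preconnectedSpace ⟨x, hxy⟩ ⟨y, rfl⟩

section

variable {n m : ℕ} {M S : Type*} [TopologicalSpace M]
  [ChartedSpace (EuclideanSpace ℝ (Fin n)) M] [TopologicalSpace S]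
  [ChartedSpace (EuclideanSpace ℝ (Fin m)) S]
  {Φ : M → S} {x₀ : M} {e : OpenPartialHomeomorph M (EuclideanSpace ℝ (Fin n))}
  {ℓ : EuclideanSpace ℝ (Fin n) →L[ℝ] EuclideanSpace ℝ (Fin m)}

namespace IsStraightening

theorem vderiv_bijective (h : IsStraightening Φ x₀ e ℓ) {x : M} (hx : x ∈ e.source) :
    Function.Bijective (vderiv (n := n) e x) :=
  h.mdifferentiable.mfderiv_bijective hx

theorem hasFDerivAt_comp_symm (h : IsStraightening Φ x₀ e ℓ) {E : Type*} [NormedAddCommGroup E]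
    [NormedSpace ℝ E] {g : M → E} {x : M} (hx : x ∈ e.source)
    (hg : MDifferentiableAt (𝓡 n) 𝓘(ℝ, E) g x) :
    ∃ L : EuclideanSpace ℝ (Fin n) →L[ℝ] E, HasFDerivAt (g ∘ e.symm) L (e x) ∧
      ∀ w : TangentSpace (𝓡 n) x, L (vderiv e x w) = vderiv g x w := by
  have hd : MDifferentiableAt (𝓡 n) 𝓘(ℝ, E) (g ∘ e.symm) (e x) := by
    refine MDifferentiableAt.comp (e x) (g := g) (I' := 𝓡 n) ?_
      (h.mdifferentiable.mdifferentiableAt_symm (e.map_source hx))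
    rwa [e.left_inv hx]
  refine ⟨_, hd.differentiableAt.hasFDerivAt, fun w => ?_⟩
  have hev : (g ∘ e.symm) ∘ e =ᶠ[𝓝 x] g := by
    filter_upwards [e.open_source.mem_nhds hx] with y hy
    simp only [Function.comp, e.left_inv hy]
  have h1 : mfderiv (𝓡 n) 𝓘(ℝ, E) ((g ∘ e.symm) ∘ e) x =
      (mfderiv (𝓡 n) 𝓘(ℝ, E) (g ∘ e.symm) (e x)).comp (mfderiv (𝓡 n) (𝓡 n) e x) :=
    mfderiv_comp x hd (h.mdifferentiable.mdifferentiableAt hx)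
  unfold vderiv
  rw [← hev.mfderiv_eq, h1, mfderiv_eq_fderiv]
  rfl

end IsStraightening

variable [IsManifold (𝓡 n) ∞ M] [IsManifold (𝓡 m) ∞ S]

/-- A function whose differential kills the vectors tangent to the fibres of a submersion is locally
constant along the fibres. -/
theorem eventually_eq_of_vderiv_eq_zero (hΦ : ContMDiff (𝓡 n) (𝓡 m) ∞ Φ) (x₀ : M)
    (hsub : Function.Surjective (mfderiv (𝓡 n) (𝓡 m) Φ x₀)) {E : Type*} [NormedAddCommGroup E]
    [NormedSpace ℝ E] {h : M → E} {U : Set M} (hU : IsOpen U) (hx₀ : x₀ ∈ U)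
    (hh : ∀ x ∈ U, MDifferentiableAt (𝓡 n) 𝓘(ℝ, E) h x)
    (hker : ∀ x ∈ U, ∀ w : TangentSpace (𝓡 n) x, mfderiv (𝓡 n) (𝓡 m) Φ x w = 0 →
      vderiv h x w = 0) :
    ∀ᶠ x in 𝓝 x₀, Φ x = Φ x₀ → h x = h x₀ := by
  obtain ⟨e, ℓ, he⟩ := exists_isStraightening hΦ x₀ hsub
  have hO : IsOpen (e.target ∩ e.symm ⁻¹' U) := e.symm.isOpen_inter_preimage hU
  have hp₀ : e x₀ ∈ e.target ∩ e.symm ⁻¹' U := by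
    refine ⟨e.map_source he.mem_source, ?_⟩
    rwa [Set.mem_preimage, e.left_inv he.mem_source]
  obtain ⟨ε, hε, hball⟩ := Metric.isOpen_iff.1 hO _ hp₀
  filter_upwards [e.open_source.mem_nhds he.mem_source,
    (e.continuousAt he.mem_source).preimage_mem_nhds (Metric.ball_mem_nhds _ hε)] with x hx hxε hΦx
  have hv : ℓ (e x - e x₀) = 0 := by
    rw [map_sub, ← he.chart_eq x hx, ← he.chart_eq x₀ he.mem_source, hΦx, sub_self]
  have hline : ∀ t ∈ Set.Icc (0 : ℝ) 1, e x₀ + t • (e x - e x₀) ∈ Metric.ball (e x₀) ε := by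
    intro t ht
    refine (convex_ball (e x₀) ε).add_smul_sub_mem (Metric.mem_ball_self hε) hxε ht
  have hder : ∀ t ∈ Set.Icc (0 : ℝ) 1,
      HasDerivAt (fun t : ℝ => (h ∘ e.symm) (e x₀ + t • (e x - e x₀))) 0 t := by
    intro t ht
    set q := e x₀ + t • (e x - e x₀) with hq
    obtain ⟨hqt, hqU⟩ := hball (hline t ht)
    have hqs : e.symm q ∈ e.source := e.map_target hqt
    obtain ⟨L, hL, hLw⟩ := he.hasFDerivAt_comp_symm hqs (hh _ hqU)
    rw [e.right_inv hqt] at hL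
    obtain ⟨w, hw⟩ := (he.vderiv_bijective hqs).2 (e x - e x₀)
    have hl : HasDerivAt (fun t : ℝ => e x₀ + t • (e x - e x₀)) (e x - e x₀) t := by
      simpa using ((hasDerivAt_id t).smul_const (e x - e x₀)).const_add (e x₀)
    have h0 : L (e x - e x₀) = 0 := by
      rw [← hw, hLw]
      refine hker _ hqU w ((he.mfderiv_eq_zero_iff hΦ hqs w).2 ?_)
      rw [hw, hv]
    rw [← h0]
    exact hL.comp_hasDerivAt t hl
  have hconst := constant_of_has_deriv_right_zero
    (fun t ht => (hder t ht).continuousAt.continuousWithinAt)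
    (fun t ht => (hder t (Set.Ico_subset_Icc_self ht)).hasDerivWithinAt) 1
    (Set.right_mem_Icc.2 zero_le_one)
  simpa [e.left_inv hx, e.left_inv he.mem_source] using hconst

/-- Every vector tangent to a fibre of a submersion is the velocity of a smooth curve, defined for
all times, in this fibre. -/
theorem exists_curve_in_fibre (hΦ : ContMDiff (𝓡 n) (𝓡 m) ∞ Φ) (x₀ : M)
    (hsub : Function.Surjective (mfderiv (𝓡 n) (𝓡 m) Φ x₀)) {w : TangentSpace (𝓡 n) x₀}
    (hw : mfderiv (𝓡 n) (𝓡 m) Φ x₀ w = 0) :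
    ∃ c : ℝ → M, ContMDiff 𝓘(ℝ, ℝ) (𝓡 n) ∞ c ∧ (∀ t, Φ (c t) = Φ x₀) ∧ c 0 = x₀ ∧
      (w ≠ 0 → mfderiv 𝓘(ℝ, ℝ) (𝓡 n) c 0 ≠ 0) ∧
      ∀ (E : Type) [NormedAddCommGroup E] [NormedSpace ℝ E] (g : M → E),
        MDifferentiableAt (𝓡 n) 𝓘(ℝ, E) g x₀ → HasDerivAt (g ∘ c) (vderiv g x₀ w) 0 := by
  obtain ⟨e, ℓ, he⟩ := exists_isStraightening hΦ x₀ hsub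
  obtain ⟨ε, hε, hball⟩ := Metric.isOpen_iff.1 e.open_target _ (e.map_source he.mem_source)
  set v : EuclideanSpace ℝ (Fin n) := vderiv e x₀ w with hv
  have hℓv : ℓ v = 0 := (he.mfderiv_eq_zero_iff hΦ he.mem_source w).1 hw
  -- The factor `δ` and the sine keep the curve inside the ball for all times.
  obtain ⟨δ, hδ, hδv⟩ : ∃ δ : ℝ, 0 < δ ∧ δ * ‖v‖ < ε := by
    refine ⟨ε / (‖v‖ + 1), by positivity, ?_⟩
    rw [div_mul_eq_mul_div, div_lt_iff₀ (by positivity)]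
    nlinarith [norm_nonneg v]
  let p : ℝ → EuclideanSpace ℝ (Fin n) := fun t => e x₀ + (δ * Real.sin (t / δ)) • v
  have hpmem : ∀ t, p t ∈ e.target := by
    intro t
    refine hball ?_
    simp only [p, Metric.mem_ball, dist_self_add_left, norm_smul, norm_mul, Real.norm_eq_abs,
      abs_of_pos hδ]
    have := Real.abs_sin_le_one (t / δ)
    refine lt_of_le_of_lt ?_ hδv
    gcongr
    nlinarith
  have hp : ContDiff ℝ ∞ p := by
    have h1 : ContDiff ℝ ∞ fun t : ℝ => δ * Real.sin (t / δ) :=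
      contDiff_const.mul (Real.contDiff_sin.comp (contDiff_id.div_const δ))
    exact contDiff_const.add (h1.smul contDiff_const)
  have hp0 : p 0 = e x₀ := by simp [p]
  have hp' : HasDerivAt p v 0 := by
    have h1 : HasDerivAt (fun t : ℝ => δ * Real.sin (t / δ)) 1 0 := by
      have h2 : HasDerivAt (fun t : ℝ => t / δ) (1 / δ) 0 := (hasDerivAt_id 0).div_const δ
      have h3 := (h2.sin).const_mul δ
      simp only [zero_div, Real.cos_zero, one_mul] at h3
      rwa [mul_one_div_cancel hδ.ne'] at h3
    have h4 := (h1.smul_const v).const_add (e x₀)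
    rwa [one_smul] at h4
  have hderiv : ∀ (E : Type) [NormedAddCommGroup E] [NormedSpace ℝ E] (g : M → E),
        MDifferentiableAt (𝓡 n) 𝓘(ℝ, E) g x₀ →
          HasDerivAt (g ∘ (e.symm ∘ p)) (vderiv g x₀ w) 0 := by
    intro E _ _ g hg
    obtain ⟨L, hL, hLw⟩ := he.hasFDerivAt_comp_symm he.mem_source hg
    rw [← hp0] at hL
    rw [← hLw]
    exact hL.comp_hasDerivAt 0 hp'
  have hc : ContMDiff 𝓘(ℝ, ℝ) (𝓡 n) ∞ (e.symm ∘ p) :=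
    he.contMDiffOn_symm.comp_contMDiff hp.contMDiff hpmem
  have hc0 : (e.symm ∘ p) 0 = x₀ := by
    simp only [Function.comp, hp0, e.left_inv he.mem_source]
  refine ⟨e.symm ∘ p, hc, ?_, hc0, ?_, hderiv⟩
  · intro t
    have hs : e.symm (p t) ∈ e.source := e.map_target (hpmem t)
    refine (chartAt (EuclideanSpace ℝ (Fin m)) (Φ x₀)).injOn (he.mem_chart_source _ hs)
      (mem_chart_source _ _) ?_
    rw [he.chart_eq x₀ he.mem_source]
    rw [he.chart_eq _ hs, e.right_inv (hpmem t)]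
    simp [p, hℓv]
  · intro hw0 hzero
    have h1 : HasDerivAt (e ∘ (e.symm ∘ p)) v 0 := hderiv _ e
      (he.mdifferentiable.mdifferentiableAt he.mem_source)
    have h2 : MDifferentiableAt (𝓡 n) (𝓡 n) e ((e.symm ∘ p) 0) := by
      rw [hc0]; exact he.mdifferentiable.mdifferentiableAt he.mem_source
    have h3 := h2.hasMFDerivAt.comp (0 : ℝ) (hc.mdifferentiable (by simp) 0).hasMFDerivAt
    rw [hzero, ContinuousLinearMap.comp_zero] at h3
    have h4 : v = 0 := by
      have h5 := h1.hasFDerivAt.hasMFDerivAt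
      have h6 : (1 : ℝ) • v = 0 := congrArg (fun A : ℝ →L[ℝ] EuclideanSpace ℝ (Fin n) => A 1)
        (hasMFDerivAt_unique h5 h3)
      rwa [one_smul] at h6
    refine hw0 ((map_eq_zero_iff _ (he.vderiv_bijective he.mem_source).1).1 ?_)
    rw [← hv, h4]

end

section

variable {n n' m m' : ℕ} {M M' S S' : Type*} [TopologicalSpace M]
  [ChartedSpace (EuclideanSpace ℝ (Fin n)) M] [IsManifold (𝓡 n) ∞ M] [TopologicalSpace S]
  [ChartedSpace (EuclideanSpace ℝ (Fin m)) S] [IsManifold (𝓡 m) ∞ S] [TopologicalSpace S']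
  [ChartedSpace (EuclideanSpace ℝ (Fin m')) S'] [TopologicalSpace M']
  [ChartedSpace (EuclideanSpace ℝ (Fin n')) M'] [IsManifold (𝓡 n') ∞ M']

/-- A map out of the base of a surjective submersion is smooth if its pull-back is: locally it is
the composition of the pull-back with a section. -/
theorem contMDiff_of_comp_submersion {Φ : M → S} (hΦ : ContMDiff (𝓡 n) (𝓡 m) ∞ Φ)
    (hsurj : Function.Surjective Φ)
    (hsub : ∀ x, Function.Surjective (mfderiv (𝓡 n) (𝓡 m) Φ x)) {φ : S → S'}
    (hφ : ContMDiff (𝓡 n) (𝓡 m') ∞ (φ ∘ Φ)) : ContMDiff (𝓡 m) (𝓡 m') ∞ φ := by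
  intro s₀
  obtain ⟨x₀, rfl⟩ := hsurj s₀
  obtain ⟨e, ℓ, he⟩ := exists_isStraightening hΦ x₀ (hsub x₀)
  obtain ⟨R, hR⟩ := ℓ.toLinearMap.exists_rightInverse_of_surjective
    (LinearMap.range_eq_top.2 he.surjective)
  have hR' : ∀ v, ℓ (R v) = v := fun v => LinearMap.congr_fun hR v
  set c := chartAt (EuclideanSpace ℝ (Fin m)) (Φ x₀) with hc
  let q : S → EuclideanSpace ℝ (Fin n) := fun s => e x₀ + R.toContinuousLinearMap (c s - c (Φ x₀))
  have hq0 : q (Φ x₀) = e x₀ := by simp [q]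
  have hcs : ContMDiffAt (𝓡 m) (𝓡 m) ∞ c (Φ x₀) :=
    (contMDiffOn_chartAt (Φ x₀)).contMDiffAt (chart_source_mem_nhds _ _)
  have hq : ContMDiffAt (𝓡 m) (𝓡 n) ∞ q (Φ x₀) :=
    contMDiffAt_const.add (R.toContinuousLinearMap.contMDiff.contMDiffAt.comp (Φ x₀)
      (hcs.sub contMDiffAt_const))
  have hσ : ContMDiffAt (𝓡 m) (𝓡 n) ∞ (e.symm ∘ q) (Φ x₀) := by
    refine ContMDiffAt.comp (Φ x₀) (he.contMDiffOn_symm.contMDiffAt ?_) hq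
    rw [hq0]
    exact e.open_target.mem_nhds (e.map_source he.mem_source)
  refine ((hφ.contMDiffAt).comp (Φ x₀) hσ).congr_of_eventuallyEq ?_
  have htarget : q ⁻¹' e.target ∈ 𝓝 (Φ x₀) := hq.continuousAt.preimage_mem_nhds (by
    rw [hq0]; exact e.open_target.mem_nhds (e.map_source he.mem_source))
  filter_upwards [htarget, chart_source_mem_nhds (EuclideanSpace ℝ (Fin m)) (Φ x₀)] with s hs hsc
  have hs' : e.symm (q s) ∈ e.source := e.map_target hs
  have : Φ (e.symm (q s)) = s := by
    refine c.injOn (he.mem_chart_source _ hs') hsc ?_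
    rw [hc, he.chart_eq _ hs', e.right_inv hs]
    simp only [q, map_add, LinearMap.coe_toContinuousLinearMap', hR']
    rw [← he.chart_eq _ he.mem_source, hc]
    abel
  simp only [Function.comp, this]

omit [IsManifold (𝓡 n) ∞ M] in
/-- A continuous map `F` is smooth if its composition with an immersion `G` is: `G` has a smooth
local left inverse. -/
theorem contMDiffAt_of_comp_immersion {E : Type*} [NormedAddCommGroup E] [NormedSpace ℝ E]
    [FiniteDimensional ℝ E] {F : M → M'} {x₀ : M} (hF : ContinuousAt F x₀) {G : M' → E}
    (hG : ContMDiffAt (𝓡 n') 𝓘(ℝ, E) ∞ G (F x₀))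
    (hinj : Function.Injective (vderiv (n := n') G (F x₀)))
    (hGF : ContMDiffAt (𝓡 n) 𝓘(ℝ, E) ∞ (G ∘ F) x₀) : ContMDiffAt (𝓡 n) (𝓡 n') ∞ F x₀ := by
  have : IsManifold (𝓡 n') 1 M' := IsManifold.of_le (n := ∞) (by norm_cast)
  set c := chartAt (EuclideanSpace ℝ (Fin n')) (F x₀) with hc
  have hmem : F x₀ ∈ c.source := mem_chart_source _ _
  have hcs : ContMDiffAt (𝓡 n') (𝓡 n') ∞ c.symm (c (F x₀)) :=
    contMDiffOn_chart_symm.contMDiffAt (c.open_target.mem_nhds (c.map_source hmem))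
  have hy : c.symm (c (F x₀)) = F x₀ := c.left_inv hmem
  have hg : ContDiffAt ℝ ∞ (G ∘ c.symm) (c (F x₀)) := by
    rw [← contMDiffAt_iff_contDiffAt]
    refine ContMDiffAt.comp _ ?_ hcs
    rwa [hy]
  have hd := mdifferentiable_chart (I := 𝓡 n') (F x₀)
  have hinj' : Function.Injective (fderiv ℝ (G ∘ c.symm) (c (F x₀))) := by
    have hGd : MDifferentiableAt (𝓡 n') 𝓘(ℝ, E) G (c.symm (c (F x₀))) := by
      rw [hy]; exact hG.mdifferentiableAt (by simp)
    rw [← mfderiv_eq_fderiv, mfderiv_comp _ hGd (hcs.mdifferentiableAt (by simp))]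
    refine Function.Injective.comp (g := mfderiv (𝓡 n') 𝓘(ℝ, E) G (c.symm (c (F x₀)))) ?_
      (hd.symm.mfderiv_injective (c.map_source hmem))
    rw [hy]
    exact hinj
  obtain ⟨L, hL⟩ := (fderiv ℝ (G ∘ c.symm) (c (F x₀))).toLinearMap.exists_leftInverse_of_injective
    (LinearMap.ker_eq_bot.2 hinj')
  let L' : E →L[ℝ] EuclideanSpace ℝ (Fin n') := L.toContinuousLinearMap
  have hH : ContDiffAt ℝ ∞ (L' ∘ (G ∘ c.symm)) (c (F x₀)) := L'.contDiff.contDiffAt.comp _ hg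
  have hH' : HasFDerivAt (L' ∘ (G ∘ c.symm))
      ((ContinuousLinearEquiv.refl ℝ _ : EuclideanSpace ℝ (Fin n') ≃L[ℝ] _) :
        EuclideanSpace ℝ (Fin n') →L[ℝ] EuclideanSpace ℝ (Fin n')) (c (F x₀)) := by
    refine (L'.hasFDerivAt.comp _ (hg.differentiableAt (by simp)).hasFDerivAt).congr_fderiv ?_
    ext1 v
    exact LinearMap.congr_fun hL v
  let K := hH.toOpenPartialHomeomorph _ hH' (by simp)
  have hK : ContDiffAt ℝ ∞ K.symm ((L' ∘ (G ∘ c.symm)) (c (F x₀))) :=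
    hH.to_localInverse hH' (by simp)
  have hLG : ContMDiffAt (𝓡 n) (𝓡 n') ∞ (L' ∘ (G ∘ F)) x₀ :=
    L'.contMDiff.contMDiffAt.comp x₀ hGF
  have hval : (L' ∘ (G ∘ F)) x₀ = (L' ∘ (G ∘ c.symm)) (c (F x₀)) := by
    simp only [Function.comp, hy]
  have hKF : ContMDiffAt (𝓡 n) (𝓡 n') ∞ (c.symm ∘ (K.symm ∘ (L' ∘ (G ∘ F)))) x₀ := by
    have h1 : ContMDiffAt (𝓡 n) (𝓡 n') ∞ (K.symm ∘ (L' ∘ (G ∘ F))) x₀ := by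
      refine ContDiffAt.comp_contMDiffAt ?_ hLG
      rwa [hval]
    refine ContMDiffAt.comp x₀ ?_ h1
    have h2 : (K.symm ∘ (L' ∘ (G ∘ F))) x₀ = c (F x₀) := by
      change K.symm ((L' ∘ (G ∘ F)) x₀) = _
      rw [hval]
      exact K.left_inv (hH.mem_toOpenPartialHomeomorph_source hH' (by simp))
    rwa [h2]
  refine hKF.congr_of_eventuallyEq ?_
  have hcF : ContinuousAt (fun x => c (F x)) x₀ := (c.continuousAt hmem).comp hF
  filter_upwards [hF.preimage_mem_nhds (c.open_source.mem_nhds hmem),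
    hcF.preimage_mem_nhds (K.open_source.mem_nhds
      (hH.mem_toOpenPartialHomeomorph_source hH' (by simp)))] with x hx hxK
  have h1 : K (c (F x)) = (L' ∘ (G ∘ F)) x := by
    change L' (G (c.symm (c (F x)))) = L' (G (F x))
    rw [c.left_inv hx]
  change F x = c.symm (K.symm ((L' ∘ (G ∘ F)) x))
  rw [← h1, K.left_inv hxK, c.left_inv hx]

end

/-! ### Distributions invariant under the fibre directions -/

variable {n m : ℕ} {M S : Type*} [TopologicalSpace M]
  [ChartedSpace (EuclideanSpace ℝ (Fin n)) M] [TopologicalSpace S]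
  [ChartedSpace (EuclideanSpace ℝ (Fin m)) S]
  {Φ : M → S} {x₀ : M} {e : OpenPartialHomeomorph M (EuclideanSpace ℝ (Fin n))}
  {ℓ : EuclideanSpace ℝ (Fin n) →L[ℝ] EuclideanSpace ℝ (Fin m)}

theorem mem_of_vderiv_mem_imageField {E : Type*} [NormedAddCommGroup E] [NormedSpace ℝ E]
    {g : M → E} {D : PlaneField n M} {x : M} (hg : Function.Injective (vderiv (n := n) g x))
    {w : TangentSpace (𝓡 n) x} (hw : vderiv g x w ∈ imageField g D x) : w ∈ D x := by
  obtain ⟨w', hw', h⟩ := hw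
  rwa [← hg h]

/-- In coordinates `e`, the bracket of the constant field `v` with a field `W` is the derivative of
`W` in the direction `v`. -/
theorem IsStraightening.vderiv_mlieBracket [IsManifold (𝓡 n) ∞ M] (he : IsStraightening Φ x₀ e ℓ)
    {x : M} (hx : x ∈ e.source) (v : EuclideanSpace ℝ (Fin n))
    {W : EuclideanSpace ℝ (Fin n) → EuclideanSpace ℝ (Fin n)} (hW : ContDiffAt ℝ 1 W (e x)) :
    vderiv e x (VectorField.mlieBracket (𝓡 n)
      (VectorField.mpullback (𝓡 n) (𝓡 n) e fun _ => v)
      (VectorField.mpullback (𝓡 n) (𝓡 n) e W) x) = fderiv ℝ W (e x) v := by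
  have : IsManifold (𝓡 n) (minSmoothness ℝ 3) M := IsManifold.of_le (n := ∞) (by
    rw [minSmoothness_of_isRCLikeNormedField]; norm_cast)
  have hinv : (mfderiv (𝓡 n) (𝓡 n) e x).IsInvertible := ⟨he.mdifferentiable.mfderiv hx, rfl⟩
  have hmd : ∀ {V : EuclideanSpace ℝ (Fin n) → EuclideanSpace ℝ (Fin n)},
      ContDiffAt ℝ 1 V (e x) → MDifferentiableAt (𝓡 n) (𝓡 n).tangent
        (fun p => (⟨p, V p⟩ : TangentBundle (𝓡 n) (EuclideanSpace ℝ (Fin n)))) (e x) := by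
    intro V hV
    exact (contMDiffAt_vectorSpace_iff_contDiffAt.2 hV).mdifferentiableAt one_ne_zero
  rw [← VectorField.mpullback_mlieBracket (n := ∞) (hmd contDiffAt_const) (hmd hW)
    (he.contMDiffOn.contMDiffAt (e.open_source.mem_nhds hx)) (by
    rw [minSmoothness_of_isRCLikeNormedField]; norm_cast)]
  rw [VectorField.mpullback_apply]
  have h1 := (hinv.inverse_apply_eq (y := VectorField.mlieBracket (𝓡 n)
    (fun _ : EuclideanSpace ℝ (Fin n) => v) W (e x))).1 rfl
  have h2 : ∀ V V' : (∀ p : EuclideanSpace ℝ (Fin n), TangentSpace (𝓡 n) p),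
      VectorField.mlieBracket (𝓡 n) V V' = VectorField.lieBracket ℝ V V' := by
    intro V V'
    rw [← VectorField.mlieBracketWithin_univ, VectorField.mlieBracketWithin_eq_lieBracketWithin]
    exact VectorField.lieBracketWithin_univ
  refine h1.symm.trans ((congrFun (h2 _ _) _).trans ?_)
  simp only [VectorField.lieBracket, fderiv_fun_const, Pi.zero_apply, zero_apply, sub_zero]
  rfl

theorem IsStraightening.vderiv_mpullback (he : IsStraightening Φ x₀ e ℓ)
    (W : EuclideanSpace ℝ (Fin n) → EuclideanSpace ℝ (Fin n)) {x : M} (hx : x ∈ e.source) :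
    vderiv e x (VectorField.mpullback (𝓡 n) (𝓡 n) e W x) = W (e x) := by
  have hinv : (mfderiv (𝓡 n) (𝓡 n) e x).IsInvertible := ⟨he.mdifferentiable.mfderiv hx, rfl⟩
  have h1 : ∀ v : TangentSpace (𝓡 n) (e x),
      mfderiv (𝓡 n) (𝓡 n) e x ((mfderiv (𝓡 n) (𝓡 n) e x).inverse v) = v :=
    fun v => ((hinv.inverse_apply_eq (y := v)).1 rfl).symm
  exact h1 (W (e x))

theorem IsStraightening.isSmoothFieldOn_mpullback [IsManifold (𝓡 n) ∞ M]
    (he : IsStraightening Φ x₀ e ℓ) {W : EuclideanSpace ℝ (Fin n) → EuclideanSpace ℝ (Fin n)}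
    (hW : ContDiffOn ℝ ∞ W e.target) :
    IsSmoothFieldOn (VectorField.mpullback (𝓡 n) (𝓡 n) e W) e.source := by
  have : IsManifold (𝓡 n) 1 M := IsManifold.of_le (n := ∞) (by norm_cast)
  intro x hx
  have hinv : (mfderiv (𝓡 n) (𝓡 n) e x).IsInvertible := ⟨he.mdifferentiable.mfderiv hx, rfl⟩
  refine (ContMDiffAt.mpullback_vectorField_preimage (n := ∞) ?_
    (he.contMDiffOn.contMDiffAt (e.open_source.mem_nhds hx)) hinv (by rfl)).contMDiffWithinAt
  exact contMDiffAt_vectorSpace_iff_contDiffAt.2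
    (hW.contDiffAt (e.open_target.mem_nhds (e.map_source hx)))

/-- The projections onto a distribution `D` invariant under the fibre directions have vanishing
derivative along the fibres: for a fixed vector `u`, the field `P(·) u` is a section of `D`, so its
derivative along a constant fibre direction, being a bracket, is in `D` as well. -/
theorem IsStraightening.vderiv_imageProj_eq_zero [IsManifold (𝓡 n) ∞ M]
    [IsManifold (𝓡 m) ∞ S] (he : IsStraightening Φ x₀ e ℓ)
    (hΦ : ContMDiff (𝓡 n) (𝓡 m) ∞ Φ) {C D : PlaneField n M}
    (hC : ∀ x, (mfderiv (𝓡 n) (𝓡 m) Φ x).toLinearMap.ker = C x) (hCD : BracketSubset C D D)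
    (hP : ∀ x ∈ e.source, ContMDiffAt (𝓡 n) 𝓘(ℝ, EuclideanSpace ℝ (Fin n) →L[ℝ] EuclideanSpace ℝ (Fin n)) ∞
      (imageProj e D) x) {x : M} (hx : x ∈ e.source) {w : TangentSpace (𝓡 n) x}
    (hw : mfderiv (𝓡 n) (𝓡 m) Φ x w = 0) :
    vderiv (imageProj e D) x w = 0 := by
  set Q : EuclideanSpace ℝ (Fin n) → EuclideanSpace ℝ (Fin n) →L[ℝ] EuclideanSpace ℝ (Fin n) :=
    imageProj e D ∘ e.symm with hQ
  have hQs : ContDiffOn ℝ ∞ Q e.target := by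
    rw [← contMDiffOn_iff_contDiffOn]
    intro p hp
    exact ((hP _ (e.map_target hp)).comp p
      (he.contMDiffOn_symm.contMDiffAt (e.open_target.mem_nhds hp))).contMDiffWithinAt
  obtain ⟨L, hL, hLw⟩ := he.hasFDerivAt_comp_symm hx ((hP x hx).mdifferentiableAt (by simp))
  rw [← hQ] at hL
  have hQx : Q (e x) = imageProj e D x := by simp only [hQ, Function.comp, e.left_inv hx]
  set v : EuclideanSpace ℝ (Fin n) := vderiv e x w with hv
  have hℓv : ℓ v = 0 := (he.mfderiv_eq_zero_iff hΦ hx w).1 hw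
  rw [← hLw, ← hv]
  -- The derivatives of `P² = P` and of `⟪P a, b⟫ = ⟪a, P b⟫` in the direction `v`.
  have hidem : (L v).comp (Q (e x)) + (Q (e x)).comp (L v) = L v := by
    have h1 := hL.clm_comp hL
    have hQQ : (fun p => (Q p).comp (Q p)) = Q := funext fun p =>
      ((imageField e D (e.symm p)).isIdempotentElem_starProjection).eq
    rw [hQQ] at h1
    have h2 := congrArg (fun A : EuclideanSpace ℝ (Fin n) →L[ℝ] EuclideanSpace ℝ (Fin n) →L[ℝ]
      EuclideanSpace ℝ (Fin n) => A v) (h1.unique hL)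
    simp only [add_apply, ContinuousLinearMap.comp_apply, ContinuousLinearMap.compL_apply,
      ContinuousLinearMap.flip_apply] at h2
    rwa [add_comm] at h2
  have hsymmP : ∀ p, (Q p).toLinearMap.IsSymmetric := fun p =>
    (imageField e D (e.symm p)).starProjection_isSymmetric
  have hsymm : (L v).toLinearMap.IsSymmetric := by
    intro a b
    have h1 := (hL.clm_apply (hasFDerivAt_const a (e x))).inner ℝ (hasFDerivAt_const b (e x))
    have h2 := (hasFDerivAt_const a (e x)).inner ℝ (hL.clm_apply (hasFDerivAt_const b (e x)))
    have hab : (fun p => inner ℝ (Q p a) b) = fun p => inner ℝ a (Q p b) := funext fun p =>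
      hsymmP p a b
    rw [hab] at h1
    have h3 := congrArg (fun A : EuclideanSpace ℝ (Fin n) →L[ℝ] ℝ => A v) (h1.unique h2)
    simpa [fderivInnerCLM_apply] using h3
  refine eq_zero_of_isSymmetric_of_comp_eq (hsymmP (e x)) hsymm hidem ?_
  ext1 u
  change Q (e x) (L v u) = L v u
  rw [hQx]
  refine Submodule.starProjection_eq_self_iff.2 ?_
  -- `L v u` is the bracket of the constant field `v` and of the section `P(·) u` of `D`.
  have hWs : ContDiffOn ℝ ∞ (fun p => Q p u) e.target := hQs.clm_apply contDiffOn_const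
  have hbr := hCD e.source e.open_source _ _
    (he.isSmoothFieldOn_mpullback (W := fun _ => v) contDiffOn_const)
    (he.isSmoothFieldOn_mpullback hWs) ?_ ?_ x hx
  · have h1 := he.vderiv_mlieBracket hx v (W := fun p => Q p u)
      ((hWs.contDiffAt (e.open_target.mem_nhds (e.map_source hx))).of_le (by norm_cast))
    have h2 : fderiv ℝ (fun p => Q p u) (e x) v = L v u := by
      rw [(hL.clm_apply (hasFDerivAt_const u (e x))).fderiv]
      simp
    rw [← h2, ← h1]
    exact ⟨_, hbr, rfl⟩
  · intro y hy
    rw [← hC y]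
    refine (he.mfderiv_eq_zero_iff hΦ hy _).2 ?_
    rw [he.vderiv_mpullback _ hy, hℓv]
  · intro y hy
    refine mem_of_vderiv_mem_imageField (he.vderiv_bijective hy).1 ?_
    rw [he.vderiv_mpullback _ hy]
    simp only [hQ, Function.comp, e.left_inv hy]
    exact Submodule.starProjection_apply_mem _ u

variable [IsManifold (𝓡 n) ∞ M] [IsManifold (𝓡 m) ∞ S]

omit [IsManifold (𝓡 n) ∞ M] in
/-- Pointed subspaces with the same base point are equal if they agree in a chart; the pairing with
the base point allows tangent spaces at propositionally equal points to be compared. -/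
theorem sigma_submodule_ext {s₀ : S} {z z' : Σ γ : S, Submodule ℝ (TangentSpace (𝓡 m) γ)}
    (h : z.1 = z'.1) (hz : z.1 ∈ (chartAt (EuclideanSpace ℝ (Fin m)) s₀).source)
    (hmap : z.2.map (vderiv (chartAt (EuclideanSpace ℝ (Fin m)) s₀) z.1).toLinearMap =
      z'.2.map (vderiv (chartAt (EuclideanSpace ℝ (Fin m)) s₀) z'.1).toLinearMap) : z = z' := by
  obtain ⟨γ, P⟩ := z
  obtain ⟨γ', P'⟩ := z'
  obtain rfl : γ = γ' := h
  exact congrArg _ (Submodule.map_injective_of_injective (vderiv_chartAt_injective hz) hmap)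

/-- The push-forward by `Φ` of a distribution invariant under the fibre directions is constant on
the fibres. -/
theorem map_mfderiv_eq_of_fibre {C D : PlaneField n M} (hD : IsDistribution D)
    (hΦ : IsLeafProjection (m := m) C Φ) (hCD : BracketSubset C D D) {x y : M}
    (hxy : Φ x = Φ y) :
    (⟨Φ x, (D x).map (mfderiv (𝓡 n) (𝓡 m) Φ x).toLinearMap⟩ :
      Σ γ : S, Submodule ℝ (TangentSpace (𝓡 m) γ)) =
      ⟨Φ y, (D y).map (mfderiv (𝓡 n) (𝓡 m) Φ y).toLinearMap⟩ := by
  refine eq_of_eventually_eq_on_fibre hΦ.connected (h := fun x =>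
    (⟨Φ x, (D x).map (mfderiv (𝓡 n) (𝓡 m) Φ x).toLinearMap⟩ :
      Σ γ : S, Submodule ℝ (TangentSpace (𝓡 m) γ))) (fun x₀ => ?_) hxy
  obtain ⟨e, ℓ, he⟩ := exists_isStraightening hΦ.smooth x₀ (hΦ.submersion x₀)
  have hrank : ∀ x ∈ e.source, Module.finrank ℝ (imageField e D x) = Module.finrank ℝ (D x) :=
    fun x hx => (LinearEquiv.finrank_eq (Submodule.equivMapOfInjective _ (he.vderiv_bijective hx).1 _)).symm
  have hP : ∀ x ∈ e.source, ContMDiffAt (𝓡 n) 𝓘(ℝ, EuclideanSpace ℝ (Fin n) →L[ℝ] EuclideanSpace ℝ (Fin n)) ∞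
      (imageProj e D) x := fun x hx =>
    hD.contMDiffAt_imageProj e.open_source he.contMDiffOn hx (by
      filter_upwards [hD.eventually_finrank_eq x, e.open_source.mem_nhds hx] with y hy hys
      rw [hrank y hys, hrank x hx, hy])
  filter_upwards [eventually_eq_of_vderiv_eq_zero hΦ.smooth x₀ (hΦ.submersion x₀) e.open_source
    he.mem_source (fun x hx => (hP x hx).mdifferentiableAt (by simp))
    (fun x hx w hw => he.vderiv_imageProj_eq_zero hΦ.smooth hΦ.ker_eq hCD hP hx hw),
    e.open_source.mem_nhds he.mem_source] with x hx hxs hΦx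
  have himg : imageField e D x = imageField e D x₀ := by
    have h1 : imageProj e D x = imageProj e D x₀ := hx hΦx
    rw [← (imageField e D x).range_starProjection, ← (imageField e D x₀).range_starProjection]
    exact congrArg (fun A => LinearMap.range (ContinuousLinearMap.toLinearMap A)) h1
  have hmap : ∀ y ∈ e.source, ((D y).map (mfderiv (𝓡 n) (𝓡 m) Φ y).toLinearMap).map
      (vderiv (chartAt (EuclideanSpace ℝ (Fin m)) (Φ x₀)) (Φ y)).toLinearMap =
        (imageField e D y).map ℓ.toLinearMap := by
    intro y hy
    rw [imageField, ← Submodule.map_comp, ← Submodule.map_comp]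
    congr 1
    ext1 w
    exact he.vderiv_chart_comp hΦ.smooth hy w
  refine sigma_submodule_ext (s₀ := Φ x₀) hΦx (he.mem_chart_source x hxs) ?_
  rw [hmap x hxs, hmap x₀ he.mem_source, himg]

/-! ### Functoriality of flags, and the flag structures of equivalent tuples -/

section PushFlag

variable {n m k : ℕ} {M S N : Type*} [TopologicalSpace M]
  [ChartedSpace (EuclideanSpace ℝ (Fin n)) M] [TopologicalSpace S]
  [ChartedSpace (EuclideanSpace ℝ (Fin m)) S] [TopologicalSpace N]
  [ChartedSpace (EuclideanSpace ℝ (Fin k)) N]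

/-- The image of a pointed flag under the differential of a map. -/
noncomputable def pushFlag (f : M → S) (z : Σ x : M, Flag n x) : Σ γ : S, Flag m γ :=
  ⟨f z.1, fun i => (z.2 i).map (mfderiv (𝓡 n) (𝓡 m) f z.1).toLinearMap⟩

theorem flagMap_eq_pushFlag (V : ℤ → PlaneField n M) (Φ : M → S) (x : M) :
    flagMap (m := m) V Φ x = pushFlag Φ ⟨x, fun i => V i x⟩ := rfl

theorem pushFlag_comp {f : M → S} {g : S → N} {z : Σ x : M, Flag n x}
    (hg : MDifferentiableAt (𝓡 m) (𝓡 k) g (f z.1)) (hf : MDifferentiableAt (𝓡 n) (𝓡 m) f z.1) :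
    pushFlag (m := k) (g ∘ f) z = pushFlag g (pushFlag (m := m) f z) := by
  unfold pushFlag
  congr 1
  funext i
  rw [← Submodule.map_comp, mfderiv_comp _ hg hf]
  rfl

theorem pushFlag_id (z : Σ x : M, Flag n x) : pushFlag (m := n) (id : M → M) z = z := by
  unfold pushFlag
  obtain ⟨x, Λ⟩ := z
  congr 1
  funext i
  rw [mfderiv_id]
  exact Submodule.map_id _

theorem pushFlag_eq_of_carries {F : M ≃ₘ^∞⟮𝓡 n, 𝓡 m⟯ S} {V : ℤ → PlaneField n M}
    {V' : ℤ → PlaneField m S} (h : ∀ i, Carries F (V i) (V' i)) (x : M) :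
    pushFlag (m := m) F ⟨x, fun i => V i x⟩ = ⟨F x, fun i => V' i (F x)⟩ := by
  unfold pushFlag
  congr 1
  funext i
  exact h i x

theorem pushFlag_symm_pushFlag (F : M ≃ₘ^∞⟮𝓡 n, 𝓡 m⟯ S) (z : Σ x : M, Flag n x) :
    pushFlag (m := n) F.symm (pushFlag (m := m) F z) = z := by
  rw [← pushFlag_comp (F.symm.mdifferentiable (by simp) _) (F.mdifferentiable (by simp) _)]
  have : (F.symm ∘ F : M → M) = id := funext F.symm_apply_apply
  rw [this, pushFlag_id]

theorem mfderiv_diffeomorph_bijective (F : M ≃ₘ^∞⟮𝓡 n, 𝓡 m⟯ S) (x : M) :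
    Function.Bijective (mfderiv (𝓡 n) (𝓡 m) F x) :=
  (F.mfderivToContinuousLinearEquiv (by simp) x).bijective

theorem Carries.symm {F : M ≃ₘ^∞⟮𝓡 n, 𝓡 m⟯ S} {D : PlaneField n M} {D' : PlaneField m S}
    (h : Carries F D D') : Carries F.symm D' D := by
  intro y
  obtain ⟨x, rfl⟩ := F.surjective y
  have h1 := congrArg (pushFlag (m := n) F.symm)
    (pushFlag_eq_of_carries (V := fun _ => D) (V' := fun _ => D') (fun _ => h) x)
  rw [pushFlag_symm_pushFlag] at h1
  have h2 : (⟨F.symm (F x), fun _ => D (F.symm (F x))⟩ : Σ x : M, Flag n x) =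
      ⟨x, fun _ => D x⟩ := by rw [F.symm_apply_apply]
  have h3 := eq_of_heq (Sigma.mk.inj (h2.trans h1)).2
  exact (congrFun h3 0).symm

end PushFlag

section Linearization

variable {n n' m m' : ℕ} {M M' S S' : Type*}
  [TopologicalSpace M] [ChartedSpace (EuclideanSpace ℝ (Fin n)) M] [IsManifold (𝓡 n) ∞ M]
  [TopologicalSpace M'] [ChartedSpace (EuclideanSpace ℝ (Fin n')) M'] [IsManifold (𝓡 n') ∞ M']
  [TopologicalSpace S] [ChartedSpace (EuclideanSpace ℝ (Fin m)) S] [IsManifold (𝓡 m) ∞ S]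
  [TopologicalSpace S'] [ChartedSpace (EuclideanSpace ℝ (Fin m')) S'] [IsManifold (𝓡 m') ∞ S']

omit [IsManifold (𝓡 n) ∞ M] [IsManifold (𝓡 m) ∞ S] in
theorem IsLeafProjection.mfderiv_eq_zero_iff {C : PlaneField n M} {Φ : M → S}
    (hΦ : IsLeafProjection (m := m) C Φ) {x : M} {w : TangentSpace (𝓡 n) x} :
    mfderiv (𝓡 n) (𝓡 m) Φ x w = 0 ↔ w ∈ C x := by
  rw [← hΦ.ker_eq x]; rfl

theorem linearization_Δ {T : DistributionTuple n M} (hT : T.IsAdmissible) {Φ : M → S}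
    (hΦ : IsLeafProjection (m := m) T.C Φ) (x : M) :
    (linearization (m := m) T Φ).Δ (Φ x) =
      (T.Δ x).map (mfderiv (𝓡 n) (𝓡 m) Φ x).toLinearMap := by
  refine le_antisymm (sSup_le ?_) (le_sSup ⟨x, rfl⟩)
  rintro P ⟨y, hy⟩
  have h := map_mfderiv_eq_of_fibre T.isDistribution_Δ hΦ hT.C_symm (congrArg Sigma.fst hy)
  exact (eq_of_heq (Sigma.mk.inj (hy.symm.trans h)).2).le

/-- `flagMap` of a constant family computes the push-forward of the distribution `Δ`. -/
theorem flagMap_Δ {T : DistributionTuple n M} (hT : T.IsAdmissible) {Φ : M → S}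
    (hΦ : IsLeafProjection (m := m) T.C Φ) (x : M) :
    flagMap (m := m) (fun _ => T.Δ) Φ x =
      ⟨Φ x, fun _ => (linearization (m := m) T Φ).Δ (Φ x)⟩ := by
  rw [linearization_Δ hT hΦ]; rfl

/-- A smooth map whose differential kills the vectors tangent to the leaves factors through the
leaf space. -/
theorem IsLeafProjection.exists_factorization {C : PlaneField n M} {Φ : M → S}
    (hΦ : IsLeafProjection (m := m) C Φ) {Ψ : M → S'} (hΨ : ContMDiff (𝓡 n) (𝓡 m') ∞ Ψ)
    (hker : ∀ x, ∀ w ∈ C x, mfderiv (𝓡 n) (𝓡 m') Ψ x w = 0) :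
    ∃ φ : S → S', ContMDiff (𝓡 m) (𝓡 m') ∞ φ ∧ φ ∘ Φ = Ψ := by
  have hconst : ∀ x y, Φ x = Φ y → Ψ x = Ψ y := by
    intro x y hxy
    refine eq_of_eventually_eq_on_fibre hΦ.connected (fun x₀ => ?_) hxy
    set c := chartAt (EuclideanSpace ℝ (Fin m')) (Ψ x₀) with hc
    have hU : IsOpen (Ψ ⁻¹' c.source) := c.open_source.preimage hΨ.continuous
    have hx₀ : x₀ ∈ Ψ ⁻¹' c.source := mem_chart_source _ (Ψ x₀)
    have hcd : ∀ x ∈ Ψ ⁻¹' c.source, MDifferentiableAt (𝓡 m') (𝓡 m') c (Ψ x) := fun x hx =>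
      mdifferentiableAt_chartAt hx
    have hΨd : ∀ x, MDifferentiableAt (𝓡 n) (𝓡 m') Ψ x := hΨ.mdifferentiable (by simp)
    filter_upwards [eventually_eq_of_vderiv_eq_zero hΦ.smooth x₀ (hΦ.submersion x₀) hU hx₀
      (h := c ∘ Ψ) (fun x hx => (hcd x hx).comp x (hΨd x)) (fun x hx w hw => by
        rw [vderiv_comp (hcd x hx) (hΨd x), hker x w (hΦ.mfderiv_eq_zero_iff.1 hw), map_zero]),
      hU.mem_nhds hx₀] with x hx hxU hΦx
    exact c.injOn hxU hx₀ (hx hΦx)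
  choose σ hσ using hΦ.surjective
  have hφ : (Ψ ∘ σ) ∘ Φ = Ψ := funext fun x => hconst _ _ (hσ (Φ x))
  exact ⟨Ψ ∘ σ, contMDiff_of_comp_submersion hΦ.smooth hΦ.surjective hΦ.submersion
    (by rwa [hφ]), hφ⟩

omit [IsManifold (𝓡 n') ∞ M'] in
theorem exists_base_map {C : PlaneField n M} {C' : PlaneField n' M'} {Φ : M → S} {Φ' : M' → S'}
    (hΦ : IsLeafProjection (m := m) C Φ) (hΦ' : IsLeafProjection (m := m') C' Φ')
    {F : M ≃ₘ^∞⟮𝓡 n, 𝓡 n'⟯ M'} (hF : Carries F C C') :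
    ∃ φ : S → S', ContMDiff (𝓡 m) (𝓡 m') ∞ φ ∧ φ ∘ Φ = Φ' ∘ F := by
  refine hΦ.exists_factorization (hΦ'.smooth.comp F.contMDiff) fun x w hw => ?_
  rw [mfderiv_comp x (hΦ'.smooth.mdifferentiable (by simp) _) (F.mdifferentiable (by simp) x)]
  refine hΦ'.mfderiv_eq_zero_iff.2 ?_
  rw [← hF x]
  exact ⟨w, hw, rfl⟩

/-- A diffeomorphism of the total spaces which respects the leaves descends to the leaf spaces. -/
theorem exists_base_diffeomorph {C : PlaneField n M} {C' : PlaneField n' M'} {Φ : M → S}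
    {Φ' : M' → S'} (hΦ : IsLeafProjection (m := m) C Φ) (hΦ' : IsLeafProjection (m := m') C' Φ')
    {F : M ≃ₘ^∞⟮𝓡 n, 𝓡 n'⟯ M'} (hF : Carries F C C') :
    ∃ φ : S ≃ₘ^∞⟮𝓡 m, 𝓡 m'⟯ S', φ ∘ Φ = Φ' ∘ F := by
  obtain ⟨φ, hφ, hφF⟩ := exists_base_map hΦ hΦ' hF
  obtain ⟨ψ, hψ, hψF⟩ := exists_base_map hΦ' hΦ hF.symm
  have h1 : ∀ x, φ (Φ x) = Φ' (F x) := congrFun hφF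
  have h2 : ∀ y, ψ (Φ' y) = Φ (F.symm y) := congrFun hψF
  refine ⟨⟨⟨φ, ψ, fun γ => ?_, fun γ => ?_⟩, hφ, hψ⟩, hφF⟩
  · obtain ⟨x, rfl⟩ := hΦ.surjective γ
    rw [h1, h2, F.symm_apply_apply]
  · obtain ⟨y, rfl⟩ := hΦ'.surjective γ
    rw [h2, h1, F.apply_symm_apply]

omit [IsManifold (𝓡 n) ∞ M] [IsManifold (𝓡 n') ∞ M'] [IsManifold (𝓡 m) ∞ S]
  [IsManifold (𝓡 m') ∞ S'] in
theorem pushFlag_flagMap {V : ℤ → PlaneField n M} {V' : ℤ → PlaneField n' M'} {Φ : M → S}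
    {Φ' : M' → S'} (hΦ : ContMDiff (𝓡 n) (𝓡 m) ∞ Φ) (hΦ' : ContMDiff (𝓡 n') (𝓡 m') ∞ Φ')
    {F : M ≃ₘ^∞⟮𝓡 n, 𝓡 n'⟯ M'} {φ : S ≃ₘ^∞⟮𝓡 m, 𝓡 m'⟯ S'} (hφ : φ ∘ Φ = Φ' ∘ F)
    (hV : ∀ i, Carries F (V i) (V' i)) (x : M) :
    pushFlag (m := m') φ (flagMap (m := m) V Φ x) = flagMap V' Φ' (F x) := by
  rw [flagMap_eq_pushFlag, flagMap_eq_pushFlag, ← pushFlag_eq_of_carries hV,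
    ← pushFlag_comp (φ.mdifferentiable (by simp) _) (hΦ.mdifferentiable (by simp) _),
    ← pushFlag_comp (hΦ'.mdifferentiable (by simp) _) (F.mdifferentiable (by simp) _), hφ]

/-- The linearization procedure is natural: equivalent tuples give equivalent flag structures. -/
theorem TupleEquiv.flagEquiv {T : DistributionTuple n M} {T' : DistributionTuple n' M'}
    (hT : T.IsAdmissible) (hT' : T'.IsAdmissible) {Φ : M → S} {Φ' : M' → S'}
    (hΦ : IsLeafProjection (m := m) T.C Φ) (hΦ' : IsLeafProjection (m := m') T'.C Φ')
    (h : TupleEquiv T T') :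
    FlagEquiv (m := m) (m' := m') (linearization T Φ) (linearization T' Φ') := by
  obtain ⟨F, hΔ, hC, hV⟩ := h
  obtain ⟨φ, hφ⟩ := exists_base_diffeomorph hΦ hΦ' hC
  have hflag := pushFlag_flagMap (V := T.V) (V' := T'.V) hΦ.smooth hΦ'.smooth hφ hV
  refine ⟨φ, fun γ => ?_, fun γ => ?_⟩
  · obtain ⟨x, rfl⟩ := hΦ.surjective γ
    have h1 := pushFlag_flagMap (V := fun _ => T.Δ) (V' := fun _ => T'.Δ) hΦ.smooth hΦ'.smooth hφ
      (fun _ => hΔ) x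
    rw [flagMap_Δ hT hΦ, flagMap_Δ hT' hΦ', ← show φ (Φ x) = Φ' (F x) from congrFun hφ x] at h1
    exact congrFun (eq_of_heq (Sigma.mk.inj h1).2) 0
  · ext Λ'
    constructor
    · rintro ⟨Λ, ⟨x, hx⟩, rfl⟩
      exact ⟨F x, by rw [← hflag, hx]; rfl⟩
    · rintro ⟨y, hy⟩
      obtain ⟨x, rfl⟩ := F.surjective y
      replace hy := (hflag x).trans hy
      have hγ : Φ x = γ := φ.injective (congrArg Sigma.fst hy)
      subst hγ
      exact ⟨_, ⟨x, rfl⟩, eq_of_heq (Sigma.mk.inj hy).2⟩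

end Linearization

/-! ### Continuity and smoothness of the flag map -/

section FlagMap

variable {n m : ℕ} {M S : Type*}
  [TopologicalSpace M] [ChartedSpace (EuclideanSpace ℝ (Fin n)) M] [IsManifold (𝓡 n) ∞ M]
  [TopologicalSpace S] [ChartedSpace (EuclideanSpace ℝ (Fin m)) S] [IsManifold (𝓡 m) ∞ S]

omit [IsManifold (𝓡 m) ∞ S] in
/-- Under the constant-rank hypothesis on `V ∩ C`, the push-forward of `V` by a map whose
differential has kernel `C` has locally constant rank. -/
theorem IsDistribution.eventually_finrank_map_eq {D C : PlaneField n M} (hD : IsDistribution D)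
    {Ψ : M → S} (hker : ∀ x, (mfderiv (𝓡 n) (𝓡 m) Ψ x).toLinearMap.ker = C x)
    (hrank : ∀ x y, Module.finrank ℝ ↥(D x ⊓ C x) = Module.finrank ℝ ↥(D y ⊓ C y)) (x₀ : M) :
    ∀ᶠ x in 𝓝 x₀,
      Module.finrank ℝ ((D x).map (mfderiv (𝓡 n) (𝓡 m) Ψ x).toLinearMap) =
        Module.finrank ℝ ((D x₀).map (mfderiv (𝓡 n) (𝓡 m) Ψ x₀).toLinearMap) := by
  have hfin : ∀ x : M, FiniteDimensional ℝ (TangentSpace (𝓡 n) x) := fun x =>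
    inferInstanceAs (FiniteDimensional ℝ (EuclideanSpace ℝ (Fin n)))
  have key : ∀ x, Module.finrank ℝ ((D x).map (mfderiv (𝓡 n) (𝓡 m) Ψ x).toLinearMap) +
      Module.finrank ℝ ↥(D x ⊓ C x) = Module.finrank ℝ (D x) := fun x => by
    rw [← hker x]
    exact finrank_map_add_finrank_inf_ker _ _
  filter_upwards [hD.eventually_finrank_eq x₀] with x hx
  have h1 := key x
  have h2 := key x₀
  have h3 := hrank x x₀
  omega

/-- The map `x ↦ (Ψ x, {Ψ_* (V i x)})` is continuous. -/
theorem flagTendsto_flagMap {V : ℤ → PlaneField n M} (hV : ∀ i, IsDistribution (V i)) {Ψ : M → S}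
    (hΨ : ContMDiff (𝓡 n) (𝓡 m) ∞ Ψ) {x₀ : M}
    (hrank : ∀ i, ∀ᶠ x in 𝓝 x₀,
      Module.finrank ℝ ((V i x).map (mfderiv (𝓡 n) (𝓡 m) Ψ x).toLinearMap) =
        Module.finrank ℝ ((V i x₀).map (mfderiv (𝓡 n) (𝓡 m) Ψ x₀).toLinearMap))
    {x : ℕ → M} (hx : Tendsto x atTop (𝓝 x₀)) :
    FlagTendsto (m := m) (fun k => flagMap V Ψ (x k)) (flagMap V Ψ x₀) := by
  have : IsManifold (𝓡 n) 1 M := IsManifold.of_le (n := ∞) (by norm_cast)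
  have : IsManifold (𝓡 m) 1 S := IsManifold.of_le (n := ∞) (by norm_cast)
  refine ⟨hΨ.continuous.continuousAt.tendsto.comp hx, fun i => ⟨hx.eventually (hrank i), ?_⟩⟩
  rintro v ⟨u, hu, rfl⟩
  obtain ⟨U, hU, hx₀, k, X, hX, hspan⟩ := hV i x₀
  -- Extend `u` to the combination of the local frame with constant coefficients, and by zero
  -- outside `U`, where the `x k` may lie for finitely many `k`.
  obtain ⟨a, rfl⟩ : ∃ a : Fin k → ℝ, ∑ j, a j • X j x₀ = u := by
    rw [SetLike.mem_coe, ← (hspan x₀ hx₀).2] at hu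
    exact (Submodule.mem_span_range_iff_exists_fun ℝ).1 hu
  classical
  let Y : ∀ y : M, TangentSpace (𝓡 n) y := fun y => if y ∈ U then ∑ j, a j • X j y else 0
  have hYU : ∀ y ∈ U, Y y = ∑ j, a j • X j y := fun y hy => if_pos hy
  have hYV : ∀ y, Y y ∈ V i y := fun y => by
    by_cases hy : y ∈ U
    · rw [hYU y hy, ← (hspan y hy).2]
      exact Submodule.sum_mem _ fun j _ =>
        Submodule.smul_mem _ _ (Submodule.subset_span ⟨j, rfl⟩)
    · rw [show Y y = 0 from if_neg hy]
      exact Submodule.zero_mem _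
  have hY : ContMDiffOn (𝓡 n) (𝓡 n).tangent ∞ (fun y => (⟨y, Y y⟩ : TangentBundle (𝓡 n) M)) U := by
    have h := ContMDiffOn.sum_section (s := Finset.univ) (n := ∞) (t := fun j y => a j • X j y)
      (fun j _ => contMDiffOn_const.smul_section (f := fun _ : M => a j) (hX j))
    exact h.congr fun y hy => by rw [hYU y hy]
  refine ⟨fun k => mfderiv (𝓡 n) (𝓡 m) Ψ (x k) (Y (x k)), fun k => ⟨_, hYV _, rfl⟩, ?_⟩
  have h1 : Tendsto (fun k => (⟨x k, Y (x k)⟩ : TangentBundle (𝓡 n) M)) atTop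
      (𝓝 ⟨x₀, Y x₀⟩) :=
    (hY.continuousOn.continuousAt (hU.mem_nhds hx₀)).tendsto.comp hx
  rw [hYU x₀ hx₀] at h1
  exact ((hΨ.continuous_tangentMap (by simp)).tendsto _).comp h1

/-- The `i`-th subspace of a pointed flag, read in the preferred chart at `s₀`. -/
noncomputable def chartSubspace (s₀ : S) (i : ℤ) (z : Σ γ : S, Flag m γ) :
    Submodule ℝ (EuclideanSpace ℝ (Fin m)) :=
  (z.2 i).map (vderiv (chartAt (EuclideanSpace ℝ (Fin m)) s₀) z.1).toLinearMap

omit [IsManifold (𝓡 n) ∞ M] in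
theorem imageField_chart_comp {V : ℤ → PlaneField n M} {Ψ : M → S} {s₀ : S} {x : M}
    (hΨ : MDifferentiableAt (𝓡 n) (𝓡 m) Ψ x)
    (hx : Ψ x ∈ (chartAt (EuclideanSpace ℝ (Fin m)) s₀).source) (i : ℤ) :
    imageField (chartAt (EuclideanSpace ℝ (Fin m)) s₀ ∘ Ψ) (V i) x =
      chartSubspace s₀ i (flagMap V Ψ x) := by
  unfold imageField chartSubspace flagMap
  rw [← Submodule.map_comp]
  congr 1
  ext1 w
  exact vderiv_comp (mdifferentiableAt_chartAt hx) hΨ w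

/-- The map `x ↦ (Ψ x, {Ψ_* (V i x)})` is smooth, its `i`-th component being read as an orthogonal
projection in a chart of the base. -/
theorem contMDiffAt_imageProj_chart_comp {V : ℤ → PlaneField n M} (hV : ∀ i, IsDistribution (V i))
    {Ψ : M → S} (hΨ : ContMDiff (𝓡 n) (𝓡 m) ∞ Ψ) {x₀ : M}
    (hrank : ∀ i, ∀ᶠ x in 𝓝 x₀,
      Module.finrank ℝ ((V i x).map (mfderiv (𝓡 n) (𝓡 m) Ψ x).toLinearMap) =
        Module.finrank ℝ ((V i x₀).map (mfderiv (𝓡 n) (𝓡 m) Ψ x₀).toLinearMap))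
    {s₀ : S} (hs₀ : Ψ x₀ ∈ (chartAt (EuclideanSpace ℝ (Fin m)) s₀).source) (i : ℤ) :
    ContMDiffAt (𝓡 n) 𝓘(ℝ, EuclideanSpace ℝ (Fin m) →L[ℝ] EuclideanSpace ℝ (Fin m)) ∞
      (imageProj (chartAt (EuclideanSpace ℝ (Fin m)) s₀ ∘ Ψ) (V i)) x₀ := by
  set c := chartAt (EuclideanSpace ℝ (Fin m)) s₀ with hc
  have hU : IsOpen (Ψ ⁻¹' c.source) := c.open_source.preimage hΨ.continuous
  have hrank' : ∀ x ∈ Ψ ⁻¹' c.source, Module.finrank ℝ (imageField (c ∘ Ψ) (V i) x) =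
      Module.finrank ℝ ((V i x).map (mfderiv (𝓡 n) (𝓡 m) Ψ x).toLinearMap) := fun x hx => by
    rw [imageField_chart_comp (hΨ.mdifferentiable (by simp) x) hx]
    change Module.finrank ℝ (((V i x).map (mfderiv (𝓡 n) (𝓡 m) Ψ x).toLinearMap).map
      (vderiv c (Ψ x)).toLinearMap) = _
    exact (LinearEquiv.finrank_eq
      (Submodule.equivMapOfInjective _ (vderiv_chartAt_injective hx) _)).symm
  refine (hV i).contMDiffAt_imageProj hU
    ((contMDiffOn_chartAt s₀).comp hΨ.contMDiffOn fun x hx => hx) hs₀ ?_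
  filter_upwards [hrank i, hU.mem_nhds hs₀] with x hx hxU
  rw [hrank' x hxU, hrank' x₀ hs₀, hx]

/-- The flag map is an immersion: a vector on which the differentials of all its components vanish
is zero.  Such a vector is tangent to a leaf; along a curve `c` in the leaf, any `v t` in the `i`-th
subspace satisfies `P (c t) (v t) = v t`, so if the derivative of `P ∘ c` vanishes then `v' 0` is in
the image of `P (c 0)`. -/
theorem IsTautological.eq_zero_of_vderiv_eq_zero {V : ℤ → PlaneField n M} {C : PlaneField n M}
    {Φ : M → S} (hY : IsTautological (m := m) V Φ) (hΦ : IsLeafProjection (m := m) C Φ) {x₀ : M}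
    (hP : ∀ i, MDifferentiableAt (𝓡 n)
      𝓘(ℝ, EuclideanSpace ℝ (Fin m) →L[ℝ] EuclideanSpace ℝ (Fin m))
      (imageProj (chartAt (EuclideanSpace ℝ (Fin m)) (Φ x₀) ∘ Φ) (V i)) x₀)
    {w : TangentSpace (𝓡 n) x₀} (hw : mfderiv (𝓡 n) (𝓡 m) Φ x₀ w = 0)
    (hPw : ∀ i, vderiv (imageProj (chartAt (EuclideanSpace ℝ (Fin m)) (Φ x₀) ∘ Φ) (V i)) x₀ w = 0) :
    w = 0 := by
  by_contra hw0
  obtain ⟨c, hc, hcΦ, hc0, hc', hcd⟩ := exists_curve_in_fibre hΦ.smooth x₀ (hΦ.submersion x₀) hw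
  have hΛ : ∀ t, ∃ Λ : Flag m (Φ x₀), flagMap V Φ (c t) = ⟨Φ x₀, Λ⟩ := fun t => by
    rw [← hcΦ t]; exact ⟨_, rfl⟩
  choose Λ hΛ using hΛ
  obtain ⟨i, v, hv, hvΛ, hv'⟩ := hY.immersion (Φ x₀) c Λ hc hΛ (hc' hw0)
  set τ : EuclideanSpace ℝ (Fin m) →L[ℝ] EuclideanSpace ℝ (Fin m) :=
    vderiv (n := m) (chartAt (EuclideanSpace ℝ (Fin m)) (Φ x₀)) (Φ x₀) with hτ
  have hτinj : Function.Injective τ := vderiv_chartAt_injective (mem_chart_source _ (Φ x₀))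
  have himg : ∀ t, imageField (chartAt (EuclideanSpace ℝ (Fin m)) (Φ x₀) ∘ Φ) (V i) (c t) =
      chartSubspace (Φ x₀) i ⟨Φ x₀, Λ t⟩ := fun t => by
    rw [imageField_chart_comp (hΦ.smooth.mdifferentiable (by simp) _) (by
      rw [hcΦ]; exact mem_chart_source _ _), hΛ]
  let P : ℝ → EuclideanSpace ℝ (Fin m) →L[ℝ] EuclideanSpace ℝ (Fin m) :=
    imageProj (chartAt (EuclideanSpace ℝ (Fin m)) (Φ x₀) ∘ Φ) (V i) ∘ c
  have hPd : HasDerivAt P 0 0 := by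
    have h := hcd _ _ (hP i)
    rwa [hPw i] at h
  have hPv : ∀ t, P t (τ (v t)) = τ (v t) := fun t => by
    refine Submodule.starProjection_eq_self_iff.2 ?_
    rw [himg t]
    exact ⟨v t, hvΛ t, rfl⟩
  have hvd : HasDerivAt v (deriv v 0) 0 := (hv.differentiable (by simp) 0).hasDerivAt
  have hτv : HasDerivAt (fun t => τ (v t)) (τ (deriv v 0)) 0 :=
    τ.hasFDerivAt.comp_hasDerivAt 0 hvd
  have h1 := hPd.clm_apply hτv
  simp only [hPv, zero_apply, zero_add] at h1
  have h2 : P 0 (τ (deriv v 0)) = τ (deriv v 0) := h1.unique hτv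
  have h3 := Submodule.starProjection_eq_self_iff.1 h2
  rw [himg 0] at h3
  obtain ⟨u, hu, huv⟩ := h3
  have h4 : u = deriv v 0 := hτinj huv
  exact hv' (h4 ▸ hu)

end FlagMap

/-- In a finite-dimensional space, the intersection of a family of subspaces is the intersection of
finitely many of them. -/
theorem exists_finset_inf_le {E ι : Type*} [AddCommGroup E] [Module ℝ E] [FiniteDimensional ℝ E]
    (p : ι → Submodule ℝ E) : ∃ J : Finset ι, ∀ i, J.inf p ≤ p i := by
  classical
  obtain ⟨_, ⟨J, rfl⟩, hJ⟩ := (wellFounded_lt (α := Submodule ℝ E)).has_min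
    (Set.range fun J : Finset ι => J.inf p) ⟨_, ⟨∅, rfl⟩⟩
  refine ⟨J, fun i => ?_⟩
  have h1 : (insert i J).inf p ≤ J.inf p := Finset.inf_mono (Finset.subset_insert i J)
  have h2 : (insert i J).inf p = J.inf p := by
    by_contra hne
    exact hJ _ ⟨insert i J, rfl⟩ (lt_of_le_of_ne h1 hne)
  rw [← h2]
  exact Finset.inf_le (Finset.mem_insert_self i J)

theorem vderiv_clm_comp {n : ℕ} {M : Type*} [TopologicalSpace M]
    [ChartedSpace (EuclideanSpace ℝ (Fin n)) M] {E E' : Type*} [NormedAddCommGroup E]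
    [NormedSpace ℝ E] [NormedAddCommGroup E'] [NormedSpace ℝ E'] (L : E →L[ℝ] E') {g : M → E}
    {x : M} (hg : MDifferentiableAt (𝓡 n) 𝓘(ℝ, E) g x) (w : TangentSpace (𝓡 n) x) :
    vderiv (L ∘ g) x w = L (vderiv g x w) := by
  unfold vderiv
  rw [mfderiv_comp x L.differentiableAt.mdifferentiableAt hg, mfderiv_eq_fderiv, L.fderiv]
  rfl

/-! ### Reconstruction of the tuple from the flag structure -/

section Reconstruction

variable {n n' m m' : ℕ} {M M' S S' : Type*}
  [TopologicalSpace M] [ChartedSpace (EuclideanSpace ℝ (Fin n)) M] [IsManifold (𝓡 n) ∞ M]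
  [TopologicalSpace M'] [ChartedSpace (EuclideanSpace ℝ (Fin n')) M'] [IsManifold (𝓡 n') ∞ M']
  [TopologicalSpace S] [ChartedSpace (EuclideanSpace ℝ (Fin m)) S] [IsManifold (𝓡 m) ∞ S]
  [TopologicalSpace S'] [ChartedSpace (EuclideanSpace ℝ (Fin m')) S'] [IsManifold (𝓡 m') ∞ S']
  {T : DistributionTuple n M} {T' : DistributionTuple n' M'} {Φ : M → S} {Φ' : M' → S'}
  {φ : S ≃ₘ^∞⟮𝓡 m, 𝓡 m'⟯ S'} {F : M → M'}

omit [IsManifold (𝓡 n) ∞ M] [IsManifold (𝓡 m) ∞ S] [IsManifold (𝓡 m') ∞ S'] in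
theorem ker_mfderiv_diffeomorph_comp {C : PlaneField n M} (hΦ : IsLeafProjection (m := m) C Φ)
    (φ : S ≃ₘ^∞⟮𝓡 m, 𝓡 m'⟯ S') (x : M) :
    (mfderiv (𝓡 n) (𝓡 m') (φ ∘ Φ) x).toLinearMap.ker = C x := by
  rw [← hΦ.ker_eq x,
    mfderiv_comp x (φ.mdifferentiable (by simp) _) (hΦ.smooth.mdifferentiable (by simp) x)]
  ext w
  exact map_eq_zero_iff _ (mfderiv_diffeomorph_bijective φ (Φ x)).1

omit [IsManifold (𝓡 m) ∞ S] [IsManifold (𝓡 m') ∞ S'] in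
theorem eventually_finrank_diffeomorph_comp (hT : T.IsAdmissible)
    (hΦ : IsLeafProjection (m := m) T.C Φ) (φ : S ≃ₘ^∞⟮𝓡 m, 𝓡 m'⟯ S') (x₀ : M) (i : ℤ) :
    ∀ᶠ x in 𝓝 x₀,
      Module.finrank ℝ ((T.V i x).map (mfderiv (𝓡 n) (𝓡 m') (φ ∘ Φ) x).toLinearMap) =
        Module.finrank ℝ ((T.V i x₀).map (mfderiv (𝓡 n) (𝓡 m') (φ ∘ Φ) x₀).toLinearMap) :=
  (T.isDistribution_V i).eventually_finrank_map_eq (ker_mfderiv_diffeomorph_comp hΦ φ)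
    (hT.rank_inter i) x₀

omit [IsManifold (𝓡 n') ∞ M'] [IsManifold (𝓡 m) ∞ S] in
theorem continuous_of_flagMap_eq [FirstCountableTopology M] (hT : T.IsAdmissible)
    (hΦ : IsLeafProjection (m := m) T.C Φ) {V' : ℤ → PlaneField n' M'}
    (hY' : IsTautological (m := m') V' Φ')
    (hF : ∀ x, flagMap (m := m') V' Φ' (F x) = flagMap T.V (φ ∘ Φ) x) : Continuous F := by
  refine SeqContinuous.continuous fun x x₀ hx => hY'.embedding _ _ ?_
  have h : (fun k => flagMap (m := m') V' Φ' ((F ∘ x) k)) =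
      fun k => flagMap T.V (φ ∘ Φ) (x k) := funext fun k => hF (x k)
  rw [h, hF]
  exact flagTendsto_flagMap T.isDistribution_V (φ.contMDiff.comp hΦ.smooth)
    (eventually_finrank_diffeomorph_comp hT hΦ φ x₀) hx

omit [IsManifold (𝓡 m) ∞ S] in
/-- A map which intertwines the flag maps is smooth: it is continuous and its composition with the
flag map of the target, an immersion, is the flag map of the source. Finitely many components of the
flag map suffice for its differential to be injective. -/
theorem contMDiff_of_flagMap_eq [FirstCountableTopology M] (hT : T.IsAdmissible)
    (hT' : T'.IsAdmissible) (hΦ : IsLeafProjection (m := m) T.C Φ)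
    (hΦ' : IsLeafProjection (m := m') T'.C Φ') (hY' : IsTautological (m := m') T'.V Φ')
    (hF : ∀ x, flagMap (m := m') T'.V Φ' (F x) = flagMap T.V (φ ∘ Φ) x) :
    ContMDiff (𝓡 n) (𝓡 n') ∞ F := by
  have hFc : Continuous F := continuous_of_flagMap_eq hT hΦ hY' hF
  have hFφ : ∀ x, Φ' (F x) = φ (Φ x) := fun x => congrArg Sigma.fst (hF x)
  intro x₀
  set c := chartAt (EuclideanSpace ℝ (Fin m')) (Φ' (F x₀)) with hc
  have hΨ : ContMDiff (𝓡 n) (𝓡 m') ∞ (φ ∘ Φ) := φ.contMDiff.comp hΦ.smooth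
  have hmem : Φ' (F x₀) ∈ c.source := mem_chart_source _ _
  have hmem' : (φ ∘ Φ) x₀ ∈ c.source := by
    change φ (Φ x₀) ∈ c.source
    rw [← hFφ]; exact hmem
  have hP : ∀ i, ContMDiffAt (𝓡 n')
      𝓘(ℝ, EuclideanSpace ℝ (Fin m') →L[ℝ] EuclideanSpace ℝ (Fin m')) ∞
      (imageProj (c ∘ Φ') (T'.V i)) (F x₀) := fun i =>
    contMDiffAt_imageProj_chart_comp T'.isDistribution_V hΦ'.smooth
      (fun i => (T'.isDistribution_V i).eventually_finrank_map_eq hΦ'.ker_eq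
        (hT'.rank_inter i) _) hmem i
  have hQ : ∀ i, ContMDiffAt (𝓡 n)
      𝓘(ℝ, EuclideanSpace ℝ (Fin m') →L[ℝ] EuclideanSpace ℝ (Fin m')) ∞
      (imageProj (c ∘ (φ ∘ Φ)) (T.V i)) x₀ := fun i =>
    contMDiffAt_imageProj_chart_comp T.isDistribution_V hΨ
      (eventually_finrank_diffeomorph_comp hT hΦ φ x₀) hmem' i
  have hfin : FiniteDimensional ℝ (TangentSpace (𝓡 n') (F x₀)) :=
    inferInstanceAs (FiniteDimensional ℝ (EuclideanSpace ℝ (Fin n')))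
  obtain ⟨J, hJ⟩ := exists_finset_inf_le fun i : ℤ =>
    (vderiv (n := n') (imageProj (c ∘ Φ') (T'.V i)) (F x₀)).toLinearMap.ker
  let G : M' → EuclideanSpace ℝ (Fin m') ×
      (J → EuclideanSpace ℝ (Fin m') →L[ℝ] EuclideanSpace ℝ (Fin m')) :=
    fun y => (c (Φ' y), fun j => imageProj (c ∘ Φ') (T'.V j) y)
  have hcs : ContMDiffAt (𝓡 m') (𝓡 m') ∞ c (Φ' (F x₀)) :=
    (contMDiffOn_chartAt _).contMDiffAt (c.open_source.mem_nhds hmem)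
  have hcs' : ContMDiffAt (𝓡 m') (𝓡 m') ∞ c ((φ ∘ Φ) x₀) :=
    (contMDiffOn_chartAt _).contMDiffAt (c.open_source.mem_nhds hmem')
  have hG : ContMDiffAt (𝓡 n') 𝓘(ℝ, EuclideanSpace ℝ (Fin m') ×
      (J → EuclideanSpace ℝ (Fin m') →L[ℝ] EuclideanSpace ℝ (Fin m'))) ∞ G (F x₀) :=
    (hcs.comp (F x₀) hΦ'.smooth.contMDiffAt).prodMk_space
      (contMDiffAt_pi_space.2 fun j => hP j)
  have hGd : MDifferentiableAt (𝓡 n') 𝓘(ℝ, EuclideanSpace ℝ (Fin m') ×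
      (J → EuclideanSpace ℝ (Fin m') →L[ℝ] EuclideanSpace ℝ (Fin m'))) G (F x₀) :=
    hG.mdifferentiableAt (by simp)
  refine contMDiffAt_of_comp_immersion hFc.continuousAt hG ?_ ?_
  · refine (injective_iff_map_eq_zero _).2 fun w hw => ?_
    have hw1 : vderiv (c ∘ Φ') (F x₀) w = 0 := by
      have h := vderiv_clm_comp (ContinuousLinearMap.fst ℝ _ _) hGd w
      rw [hw, map_zero] at h
      exact h
    have hw2 : ∀ j : J, vderiv (imageProj (c ∘ Φ') (T'.V j)) (F x₀) w = 0 := fun j => by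
      have h := vderiv_clm_comp ((ContinuousLinearMap.proj j).comp
        (ContinuousLinearMap.snd ℝ (EuclideanSpace ℝ (Fin m'))
          (J → EuclideanSpace ℝ (Fin m') →L[ℝ] EuclideanSpace ℝ (Fin m')))) hGd w
      rw [hw, map_zero] at h
      exact h
    rw [vderiv_comp (hcs.mdifferentiableAt (by simp))
      (hΦ'.smooth.mdifferentiable (by simp) _)] at hw1
    have hw3 := (map_eq_zero_iff _ (vderiv_chartAt_injective hmem)).1 hw1
    refine hY'.eq_zero_of_vderiv_eq_zero hΦ' (fun i => (hP i).mdifferentiableAt (by simp)) hw3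
      fun i => ?_
    refine hJ i ((Submodule.mem_finsetInf).2 fun j hj => ?_)
    exact hw2 ⟨j, hj⟩
  · have hR : ContMDiffAt (𝓡 n) 𝓘(ℝ, EuclideanSpace ℝ (Fin m') ×
        (J → EuclideanSpace ℝ (Fin m') →L[ℝ] EuclideanSpace ℝ (Fin m'))) ∞
        (fun x => (c ((φ ∘ Φ) x), fun j : J => imageProj (c ∘ (φ ∘ Φ)) (T.V j) x)) x₀ :=
      (hcs'.comp x₀ hΨ.contMDiffAt).prodMk_space (contMDiffAt_pi_space.2 fun j => hQ j)
    refine hR.congr_of_eventuallyEq ?_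
    filter_upwards [(c.open_source.preimage hΨ.continuous).mem_nhds hmem'] with x hx
    have hx' : Φ' (F x) ∈ c.source := by rw [hFφ]; exact hx
    have himg : ∀ i, imageField (c ∘ Φ') (T'.V i) (F x) = imageField (c ∘ (φ ∘ Φ)) (T.V i) x := by
      intro i
      rw [imageField_chart_comp (hΦ'.smooth.mdifferentiable (by simp) _) hx',
        imageField_chart_comp (hΨ.mdifferentiable (by simp) _) hx, hF]
    simp only [G, Function.comp, hFφ, Prod.mk.injEq, true_and]
    funext j
    exact congrArg (fun K : Submodule ℝ (EuclideanSpace ℝ (Fin m')) => K.starProjection) (himg j)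

omit [IsManifold (𝓡 n) ∞ M] [IsManifold (𝓡 m) ∞ S] [IsManifold (𝓡 m') ∞ S']
  [IsManifold (𝓡 n') ∞ M'] in
theorem carries_leaf_directions {C : PlaneField n M} {C' : PlaneField n' M'}
    (hΦ : IsLeafProjection (m := m) C Φ) (hΦ' : IsLeafProjection (m := m') C' Φ')
    {F : M ≃ₘ^∞⟮𝓡 n, 𝓡 n'⟯ M'} (hF : Φ' ∘ F = φ ∘ Φ) : Carries F C C' := by
  intro x
  have key : ∀ w, mfderiv (𝓡 n) (𝓡 n') F x w ∈ C' (F x) ↔ w ∈ C x := fun w => by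
    have h := ker_mfderiv_diffeomorph_comp hΦ φ x
    rw [← hF, mfderiv_comp x (hΦ'.smooth.mdifferentiable (by simp) _)
      (F.mdifferentiable (by simp) x)] at h
    rw [← h, ← hΦ'.ker_eq]
    rfl
  ext w'
  constructor
  · rintro ⟨w, hw, rfl⟩
    exact (key w).2 hw
  · intro hw'
    obtain ⟨w, rfl⟩ := (mfderiv_diffeomorph_bijective F x).2 w'
    exact ⟨w, (key w).1 hw', rfl⟩

omit [IsManifold (𝓡 n) ∞ M] [IsManifold (𝓡 m) ∞ S] [IsManifold (𝓡 m') ∞ S']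
  [IsManifold (𝓡 n') ∞ M'] in
/-- Fields of subspaces which contain the leaf directions are determined by their push-forwards to
the leaf space. -/
theorem carries_of_flagMap_eq {C : PlaneField n M} {C' : PlaneField n' M'}
    (hΦ : IsLeafProjection (m := m) C Φ) (hΦ' : IsLeafProjection (m := m') C' Φ')
    {F : M ≃ₘ^∞⟮𝓡 n, 𝓡 n'⟯ M'} (hF : Φ' ∘ F = φ ∘ Φ) {W : ℤ → PlaneField n M}
    {W' : ℤ → PlaneField n' M'} (hW : ∀ i x, C x ≤ W i x) (hW' : ∀ i x, C' x ≤ W' i x)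
    (hflag : ∀ x, flagMap (m := m') W' Φ' (F x) = pushFlag φ (flagMap (m := m) W Φ x)) (i : ℤ) :
    Carries F (W i) (W' i) := by
  intro x
  have h := hflag x
  rw [flagMap_eq_pushFlag W, ← pushFlag_comp (φ.mdifferentiable (by simp) _)
    (hΦ.smooth.mdifferentiable (by simp) _), ← hF,
    pushFlag_comp (hΦ'.smooth.mdifferentiable (by simp) _) (F.mdifferentiable (by simp) _)] at h
  have h1 : (W' i (F x)).map (mfderiv (𝓡 n') (𝓡 m') Φ' (F x)).toLinearMap =
      ((W i x).map (mfderiv (𝓡 n) (𝓡 n') F x).toLinearMap).map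
        (mfderiv (𝓡 n') (𝓡 m') Φ' (F x)).toLinearMap :=
    congrFun (eq_of_heq (Sigma.mk.inj h).2) i
  have h2 := congrArg (Submodule.comap (mfderiv (𝓡 n') (𝓡 m') Φ' (F x)).toLinearMap) h1
  rw [Submodule.comap_map_eq, Submodule.comap_map_eq, hΦ'.ker_eq, sup_eq_left.2 (hW' i _),
    sup_eq_left.2] at h2
  · exact h2.symm
  · rw [← carries_leaf_directions hΦ hΦ' hF x]
    exact Submodule.map_mono (hW i x)

omit [IsManifold (𝓡 m) ∞ S] in
/-- The families `V i` and `V i + C` have the same push-forwards. -/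
theorem flagMap_VC (hΦ : IsLeafProjection (m := m) T.C Φ) (x : M) :
    flagMap (m := m) T.VC Φ x = flagMap T.V Φ x := by
  unfold flagMap DistributionTuple.VC
  congr 1
  funext i
  rw [Submodule.map_sup, ← hΦ.ker_eq x]
  refine sup_eq_left.2 ?_
  rintro _ ⟨w, hw, rfl⟩
  rw [show (mfderiv (𝓡 n) (𝓡 m) Φ x).toLinearMap w = 0 from hw]
  exact Submodule.zero_mem _

omit [IsManifold (𝓡 m) ∞ S] [IsManifold (𝓡 m') ∞ S'] in
/-- The fibrewise equality of sets of flags in an equivalence of flag structures, as a statement on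
pointed flags. -/
theorem pushFlag_mem_Y {𝓕 : FlagStructure m S} {𝓕' : FlagStructure m' S'}
    (hY : ∀ γ : S, (fun (Λ : Flag m γ) (i : ℤ) =>
      (Λ i).map (mfderiv (𝓡 m) (𝓡 m') φ γ).toLinearMap) '' 𝓕.Y γ = 𝓕'.Y (φ γ)) :
    (∀ z, z.2 ∈ 𝓕.Y z.1 → (pushFlag (m := m') φ z).2 ∈ 𝓕'.Y (pushFlag (m := m') φ z).1) ∧
      ∀ z', z'.2 ∈ 𝓕'.Y z'.1 → ∃ z, z.2 ∈ 𝓕.Y z.1 ∧ pushFlag (m := m') φ z = z' := by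
  constructor
  · rintro ⟨γ, Λ⟩ hΛ
    change _ ∈ 𝓕'.Y (φ γ)
    rw [← hY γ]
    exact ⟨Λ, hΛ, rfl⟩
  · rintro ⟨γ', Λ'⟩ hΛ'
    obtain ⟨γ, rfl⟩ : ∃ γ, φ γ = γ' := φ.surjective γ'
    change Λ' ∈ 𝓕'.Y (φ γ) at hΛ'
    rw [← hY γ] at hΛ'
    obtain ⟨Λ, hΛ, rfl⟩ := hΛ'
    exact ⟨⟨γ, Λ⟩, hΛ, rfl⟩

/-- An equivalence `φ` of the flag structures lifts to a diffeomorphism of the total spaces, which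
intertwines the flag maps. -/
theorem exists_diffeomorph_of_flagEquiv [FirstCountableTopology M] [FirstCountableTopology M']
    (hT : T.IsAdmissible) (hT' : T'.IsAdmissible) (hΦ : IsLeafProjection (m := m) T.C Φ)
    (hΦ' : IsLeafProjection (m := m') T'.C Φ') (hY : IsTautological (m := m) T.V Φ)
    (hY' : IsTautological (m := m') T'.V Φ')
    (hφ : ∀ γ : S, (fun (Λ : Flag m γ) (i : ℤ) =>
      (Λ i).map (mfderiv (𝓡 m) (𝓡 m') φ γ).toLinearMap) '' (linearization T Φ).Y γ =
        (linearization (m := m') T' Φ').Y (φ γ)) :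
    ∃ F : M ≃ₘ^∞⟮𝓡 n, 𝓡 n'⟯ M', ∀ x,
      flagMap (m := m') T'.V Φ' (F x) = pushFlag φ (flagMap (m := m) T.V Φ x) := by
  obtain ⟨h1, h2⟩ := pushFlag_mem_Y hφ
  have hF : ∀ x, ∃ y, flagMap (m := m') T'.V Φ' y = pushFlag φ (flagMap (m := m) T.V Φ x) :=
    fun x => h1 (flagMap T.V Φ x) ⟨x, rfl⟩
  have hG : ∀ y, ∃ x, flagMap (m := m) T.V Φ x =
      pushFlag φ.symm (flagMap (m := m') T'.V Φ' y) := fun y => by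
    obtain ⟨z, ⟨x, hx⟩, hz⟩ := h2 (flagMap T'.V Φ' y) ⟨y, rfl⟩
    exact ⟨x, by rw [← hz, pushFlag_symm_pushFlag, hx]⟩
  choose F hF using hF
  choose G hG using hG
  have hFs : ContMDiff (𝓡 n) (𝓡 n') ∞ F := contMDiff_of_flagMap_eq (φ := φ) hT hT' hΦ hΦ' hY'
    fun x => by
      rw [hF, flagMap_eq_pushFlag, ← pushFlag_comp (φ.mdifferentiable (by simp) _)
        (hΦ.smooth.mdifferentiable (by simp) _)]
      rfl
  have hGs : ContMDiff (𝓡 n') (𝓡 n) ∞ G :=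
    contMDiff_of_flagMap_eq (φ := φ.symm) hT' hT hΦ' hΦ hY fun x => by
      rw [hG, flagMap_eq_pushFlag, ← pushFlag_comp (φ.symm.mdifferentiable (by simp) _)
        (hΦ'.smooth.mdifferentiable (by simp) _)]
      rfl
  have hGF : Function.LeftInverse G F := fun x => hY.injective (by
    rw [hG, hF, pushFlag_symm_pushFlag])
  have hFG : Function.RightInverse G F := fun y => hY'.injective (by
    rw [hF, hG]; exact pushFlag_symm_pushFlag φ.symm _)
  exact ⟨⟨⟨F, G, hGF, hFG⟩, hFs, hGs⟩, hF⟩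

end Reconstruction

end FlagLinearization

theorem corollary3p1 {n n' m m' : ℕ}
    {M M' : Type u} {S : Type v} {S' : Type w}
    [TopologicalSpace M] [T2Space M] [SecondCountableTopology M]
    [ChartedSpace (EuclideanSpace ℝ (Fin n)) M] [IsManifold (𝓡 n) ∞ M]
    [TopologicalSpace M'] [T2Space M'] [SecondCountableTopology M']
    [ChartedSpace (EuclideanSpace ℝ (Fin n')) M'] [IsManifold (𝓡 n') ∞ M']
    [TopologicalSpace S] [T2Space S] [SecondCountableTopology S]
    [ChartedSpace (EuclideanSpace ℝ (Fin m)) S] [IsManifold (𝓡 m) ∞ S]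
    [TopologicalSpace S'] [T2Space S'] [SecondCountableTopology S']
    [ChartedSpace (EuclideanSpace ℝ (Fin m')) S'] [IsManifold (𝓡 m') ∞ S']
    (T : FlagLinearization.DistributionTuple n M) (T' : FlagLinearization.DistributionTuple n' M')
    (hT : T.IsAdmissible) (hT' : T'.IsAdmissible)
    (Φ : M → S) (Φ' : M' → S')
    (hΦ : FlagLinearization.IsLeafProjection (m := m) T.C Φ)
    (hΦ' : FlagLinearization.IsLeafProjection (m := m') T'.C Φ')
    (hY : FlagLinearization.IsTautological (m := m) T.V Φ)
    (hY' : FlagLinearization.IsTautological (m := m') T'.V Φ')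
    (R : FlagLinearization.IntrinsicRecovery.{u})
    (hR : R.Recovers T) (hR' : R.Recovers T') :
    FlagLinearization.TupleEquiv T T' ↔
      FlagLinearization.FlagEquiv (m := m) (m' := m')
        (FlagLinearization.linearization T Φ) (FlagLinearization.linearization T' Φ') := by
  refine ⟨FlagLinearization.TupleEquiv.flagEquiv hT hT' hΦ hΦ', ?_⟩
  rintro ⟨φ, hφΔ, hφY⟩
  obtain ⟨F, hF⟩ := FlagLinearization.exists_diffeomorph_of_flagEquiv hT hT' hΦ hΦ' hY hY' hφY
  have hFφ : Φ' ∘ F = φ ∘ Φ := funext fun x => congrArg Sigma.fst (hF x)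
  have hC : FlagLinearization.Carries F T.C T'.C :=
    FlagLinearization.carries_leaf_directions hΦ hΦ' hFφ
  have hΔ : FlagLinearization.Carries F T.Δ T'.Δ := by
    refine FlagLinearization.carries_of_flagMap_eq hΦ hΦ' hFφ (W := fun _ => T.Δ)
      (W' := fun _ => T'.Δ) (fun _ => hT.C_le) (fun _ => hT'.C_le) (fun x => ?_) 0
    rw [FlagLinearization.flagMap_Δ hT hΦ, FlagLinearization.flagMap_Δ hT' hΦ',
      show Φ' (F x) = φ (Φ x) from congrFun hFφ x, ← hφΔ (Φ x)]
    rfl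
  have hVC : ∀ i, FlagLinearization.Carries F (T.VC i) (T'.VC i) :=
    FlagLinearization.carries_of_flagMap_eq hΦ hΦ' hFφ (fun _ _ => le_sup_right)
      (fun _ _ => le_sup_right) fun x => by
        rw [FlagLinearization.flagMap_VC hΦ', FlagLinearization.flagMap_VC hΦ, hF]
  refine ⟨F, hΔ, hC, fun i => ?_⟩
  rw [← hR i, ← hR' i]
  exact R.natural n n' M M' F _ _ _ _ _ _ hΔ hC hVC i
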